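/- Let $k$ be an algebraically closed field; all curves are smooth projective connected curves over $k$, and all morphisms are over $k$. For a closed point $x$ of a curve $X$ let $\mathcal K_{X,x}$ be the fraction field of $\widehat{\mathcal O}_{X,x}$. A branch data $P$ on $X$ assigns to each closed point $x\in X$ a finite Galois extension $P(x)$ of $\mathcal K_{X,x}$ (inside a fixed algebraic closure), trivial for all but finitely many $x$; the trivial branch data is denoted by $O$. A morphism of formal orbifold curves $f:(Y,Q)\to(X,P)$ is a finite generically smooth morphism $f:Y\to X$ such that $P(f(y))\subseteq Q(y)$ for every closed point $y\in Y$ (inclusions being taken inside the algebraic closure of $\mathcal K_{Y,y}\supseteq\mathcal K_{X,f(y)}$); it is étale if $P(f(y))=Q(y)$ for every closed point $y$. It is a Galois cover if $k(Y)/k(X)$ is a Galois extension, with Galois group $\mathrm{Gal}(k(Y)/k(X))$. For a finite generically smooth morphism $f:Y\to X$ and a branch data $P$ on $X$, the branch data $f^*P$ on $Y$ is given by $(f^*P)(y)=P(f(y))\cdot\mathcal K_{Y,y}$. The morphism $f:(Y,f^*P)\to(X,P)$ is called genuinely ramified if, for every factorization $(Y,f^*P)\to(Z',Q)\to(X,P)$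 of $f$ into morphisms of formal orbifold curves whose second map is étale, the map $Z'\to X$ is an isomorphism. Let $f:(Y,f^*P)\to(X,P)$ be genuinely ramified, and let $(W,O)\to(X,P)$ be an étale Galois cover with Galois group $\Gamma$. Let $Z$ be the normalization of the fiber product $W\times_X Y$, with its projections $g:Z\to W$ and $q:Z\to Y$. Then $Z$ is a smooth projective connected curve, $g$ and $q$ are finite and generically smooth, the morphism $g:(Z,O)\to(W,O)$ is genuinely ramified, and $q:(Z,O)\to(Y,f^*P)$ is a Galois étale cover with Galois group $\Gamma$; more precisely, $g^*:k(W)\hookrightarrow k(Z)$ is equivariant for an isomorphism $\Gamma=\mathrm{Gal}(k(W)/k(X))\cong\mathrm{Gal}(k(Z)/k(Y))$. -/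

import Mathlib

open CategoryTheory CategoryTheory.Limits AlgebraicGeometry IsLocalRing

universe u

namespace FormalOrbifold

noncomputable section

section LocalAlgebra

variable {R S : Type u} [CommRing R] [IsDomain R] [IsDiscreteValuationRing R]
  [CommRing S] [IsDomain S] [IsDiscreteValuationRing S]

/-- The completion of a local ring with respect to its maximal ideal. -/
abbrev Completion (R : Type u) [CommRing R] [IsLocalRing R] : Type u :=
  AdicCompletion (maximalIdeal R) R

theorem completion_eq_unit_mul_pow {ϖ : R} (hϖ : Irreducible ϖ) {a : Completion R} (ha : a ≠ 0) :
    ∃ (n : ℕ) (v : Completion R), IsUnit v ∧ a = v * algebraMap R (Completion R) ϖ ^ n := by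
  have hm : maximalIdeal (Completion R) = Ideal.span {algebraMap R (Completion R) ϖ} := by
    have h {T : Type u} [CommRing T] (f : R →+* T) : (maximalIdeal R).map f = Ideal.span {f ϖ} := by
      rw [hϖ.maximalIdeal_eq, Ideal.map_span, Set.image_singleton]
    rw [AdicCompletion.maximalIdeal_eq_map, h]
  have hH : ∃ n : ℕ, a ∉ maximalIdeal (Completion R) ^ n := by
    by_contra! h
    refine ha (IsHausdorff.haus (I := maximalIdeal (Completion R)) inferInstance a fun n ↦ ?_)
    rw [SModEq.zero, smul_eq_mul, Ideal.mul_top]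
    exact h n
  classical
  obtain ⟨n, hn⟩ : ∃ n, Nat.find hH = n + 1 := by
    refine Nat.exists_eq_succ_of_ne_zero fun h0 ↦ ?_
    have := Nat.find_spec hH
    rw [h0] at this
    simp at this
  have h1 : a ∈ maximalIdeal (Completion R) ^ n := by
    by_contra h
    have := Nat.find_le (h := hH) h
    omega
  have h2 : a ∉ maximalIdeal (Completion R) ^ (n + 1) := hn ▸ Nat.find_spec hH
  rw [hm, Ideal.span_singleton_pow, Ideal.mem_span_singleton'] at h1
  obtain ⟨b, rfl⟩ := h1
  refine ⟨n, b, ?_, rfl⟩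
  by_contra hb
  have hbm : b ∈ maximalIdeal (Completion R) := (mem_maximalIdeal b).2 hb
  apply h2
  rw [pow_succ', ]
  refine Ideal.mul_mem_mul hbm (Ideal.pow_mem_pow ?_ n)
  rw [hm]
  exact Ideal.mem_span_singleton_self _

theorem algebraMap_completion_injective : Function.Injective (algebraMap R (Completion R)) :=
  AdicCompletion.of_injective (maximalIdeal R) R

instance completion_isDomain : IsDomain (Completion R) := by
  have : Nontrivial (Completion R) := (algebraMap_completion_injective (R := R)).nontrivial
  have : NoZeroDivisors (Completion R) := by
    refine ⟨fun {a b} hab ↦ ?_⟩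
    by_contra! h
    obtain ⟨ϖ, hϖ⟩ := IsDiscreteValuationRing.exists_irreducible R
    obtain ⟨m, v, hv, rfl⟩ := completion_eq_unit_mul_pow hϖ h.1
    obtain ⟨n, w, hw, rfl⟩ := completion_eq_unit_mul_pow hϖ h.2
    have : (v * w) * algebraMap R (Completion R) (ϖ ^ (m + n)) = 0 := by
      rw [← hab, map_pow]; ring
    rw [(hv.mul hw).mul_right_eq_zero, map_eq_zero_iff _ algebraMap_completion_injective] at this
    exact pow_ne_zero _ hϖ.ne_zero this
  exact NoZeroDivisors.to_isDomain _

theorem maximalIdeal_pow_le_comap (φ : R →+* S) [IsLocalHom φ] (n : ℕ) :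
    maximalIdeal R ^ n ≤ (maximalIdeal S ^ n).comap φ := by
  have h : (maximalIdeal R).map φ ≤ maximalIdeal S :=
    ((local_hom_TFAE φ).out 0 2).mp ‹IsLocalHom φ›
  rw [← Ideal.map_le_iff_le_comap, Ideal.map_pow]
  exact Ideal.pow_right_mono h n

/-- The map `R / 𝔪ⁿ → S / 𝔫ⁿ` induced by a local homomorphism `φ : R → S`, as a map on the
completion of `R`. -/
def truncationMap (φ : R →+* S) [IsLocalHom φ] (n : ℕ) :
    Completion R →+* S ⧸ maximalIdeal S ^ n :=
  (Ideal.quotientMap (maximalIdeal S ^ n) φ (maximalIdeal_pow_le_comap φ n)).comp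
    (AdicCompletion.evalₐ (maximalIdeal R) n : Completion R →ₐ[R] _).toRingHom

theorem factorPow_comp_truncationMap (φ : R →+* S) [IsLocalHom φ] {m n : ℕ} (hle : m ≤ n) :
    (Ideal.Quotient.factorPow (maximalIdeal S) hle).comp (truncationMap φ n) =
      truncationMap φ m := by
  ext x
  obtain ⟨r, rfl⟩ := AdicCompletion.mk_surjective _ _ x
  have h : Ideal.Quotient.mk (maximalIdeal R ^ m) (r.val n) =
      Ideal.Quotient.mk (maximalIdeal R ^ m) (r.val m) :=
    AdicCompletion.Ideal.mk_eq_mk _ hle r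
  have hmk := congrArg (Ideal.quotientMap (maximalIdeal S ^ m) φ (maximalIdeal_pow_le_comap φ m)) h
  simpa [truncationMap] using hmk

/-- The ring homomorphism on completions induced by a local homomorphism `φ`: modulo the `n`-th
powers of the maximal ideals it is the map induced by `φ`. -/
def completionMap (φ : R →+* S) [IsLocalHom φ] : Completion R →+* Completion S :=
  AdicCompletion.liftRingHom (maximalIdeal S) (truncationMap φ) (factorPow_comp_truncationMap φ)

theorem completionMap_algebraMap (φ : R →+* S) [IsLocalHom φ] (r : R) :
    completionMap φ (algebraMap R (Completion R) r) = algebraMap S (Completion S) (φ r) := by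
  refine AdicCompletion.ext_evalₐ fun n ↦ ?_
  rw [completionMap, AdicCompletion.evalₐ_liftRingHom]
  simp [truncationMap]

theorem completionMap_injective (φ : R →+* S) [IsLocalHom φ] (hφ : Function.Injective φ) :
    Function.Injective (completionMap φ) := by
  rw [injective_iff_map_eq_zero]
  intro a ha
  by_contra h
  obtain ⟨ϖ, hϖ⟩ := IsDiscreteValuationRing.exists_irreducible R
  obtain ⟨n, v, hv, rfl⟩ := completion_eq_unit_mul_pow hϖ h
  rw [map_mul, (hv.map _).mul_right_eq_zero, map_pow, completionMap_algebraMap, ← map_pow,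
    map_eq_zero_iff _ algebraMap_completion_injective, ← map_pow, map_eq_zero_iff _ hφ] at ha
  exact pow_ne_zero _ hϖ.ne_zero ha

/-- The fraction field of the completion of a discrete valuation ring. -/
abbrev CompletedField (R : Type u) [CommRing R] [IsDomain R] [IsDiscreteValuationRing R] : Type u :=
  FractionRing (Completion R)

/-- The embedding of fraction fields of completions induced by an injective local homomorphism. -/
def completedFieldMap (φ : R →+* S) [IsLocalHom φ] (hφ : Function.Injective φ) :
    CompletedField R →+* CompletedField S :=
  IsFractionRing.map (completionMap_injective φ hφ)

end LocalAlgebra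

section FieldTheory

variable {K L : Type u} [Field K] [Field L]

/-- A fixed extension of an embedding of fields `φ : K → L` to an embedding of the algebraic
closures; it identifies the algebraic closure of `K` with a subfield of that of `L`. -/
def algClosureMap (φ : K →+* L) : AlgebraicClosure K →+* AlgebraicClosure L :=
  letI : Algebra K (AlgebraicClosure L) := ((algebraMap L (AlgebraicClosure L)).comp φ).toAlgebra
  (IsAlgClosed.lift : AlgebraicClosure K →ₐ[K] AlgebraicClosure L).toRingHom

theorem algClosureMap_algebraMap (φ : K →+* L) (x : K) :
    algClosureMap φ (algebraMap K (AlgebraicClosure K) x) =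
      algebraMap L (AlgebraicClosure L) (φ x) :=
  letI : Algebra K (AlgebraicClosure L) := ((algebraMap L (AlgebraicClosure L)).comp φ).toAlgebra
  (IsAlgClosed.lift : AlgebraicClosure K →ₐ[K] AlgebraicClosure L).commutes x

/-- An algebraic extension `E` of `K`, viewed inside the algebraic closure of `L` by means of
`φ : K → L`. When `E` is normal over `K` (the only case used below), this subfield of the
algebraic closure of `L` does not depend on the chosen extension of `φ` to the algebraic
closures. -/
def transport (φ : K →+* L) (E : IntermediateField K (AlgebraicClosure K)) :
    Set (AlgebraicClosure L) :=
  algClosureMap φ '' E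

/-- The compositum `E · L` of an algebraic extension `E` of `K` with an extension `φ : K → L`,
formed inside the algebraic closure of `L`. -/
def compositum (φ : K →+* L) (E : IntermediateField K (AlgebraicClosure K)) :
    IntermediateField L (AlgebraicClosure L) :=
  IntermediateField.adjoin L (transport φ E)

theorem compositum_bot (φ : K →+* L) : compositum φ ⊥ = ⊥ := by
  rw [compositum, eq_bot_iff, IntermediateField.adjoin_le_iff]
  rintro _ ⟨x, hx, rfl⟩
  obtain ⟨x, rfl⟩ := IntermediateField.mem_bot.mp hx
  rw [algClosureMap_algebraMap]
  exact IntermediateField.algebraMap_mem _ _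

theorem exists_compositum_isSplittingField (φ : K →+* L)
    (E : IntermediateField K (AlgebraicClosure K)) [FiniteDimensional K E] [IsGalois K E] :
    ∃ p : Polynomial L, p.Separable ∧ p.IsSplittingField L (compositum φ E) := by
  obtain ⟨p, hsep, hp⟩ := IsGalois.is_separable_splitting_field K E
  have hE : E = IntermediateField.adjoin K (p.rootSet (AlgebraicClosure K)) :=
    (IntermediateField.isSplittingField_iff.mp hp).2
  have hp0 : p ≠ 0 := hsep.ne_zero
  refine ⟨p.map φ, hsep.map, ?_⟩
  have hspl : (p.map (algebraMap K (AlgebraicClosure K))).Splits := IsAlgClosed.splits _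
  have hroots : algClosureMap φ '' p.rootSet (AlgebraicClosure K) =
      (p.map φ).rootSet (AlgebraicClosure L) := by
    have hcomp : (algClosureMap φ).comp (algebraMap K (AlgebraicClosure K)) =
        (algebraMap L (AlgebraicClosure L)).comp φ :=
      RingHom.ext (algClosureMap_algebraMap φ)
    have h := hspl.roots_map (algClosureMap φ)
    rw [Polynomial.map_map, hcomp, ← Polynomial.map_map] at h
    ext x
    simp only [Polynomial.rootSet, Polynomial.aroots, h, Finset.mem_coe, Multiset.mem_toFinset,
      Multiset.mem_map, Set.mem_image]
  have : compositum φ E =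
      IntermediateField.adjoin L ((p.map φ).rootSet (AlgebraicClosure L)) := by
    rw [compositum, transport, ← hroots]
    apply le_antisymm
    · rw [IntermediateField.adjoin_le_iff]
      rintro _ ⟨x, hx, rfl⟩
      rw [SetLike.mem_coe, hE] at hx
      induction hx using IntermediateField.adjoin_induction with
      | mem x hx => exact IntermediateField.subset_adjoin _ _ ⟨x, hx, rfl⟩
      | algebraMap x =>
        rw [algClosureMap_algebraMap]
        exact IntermediateField.algebraMap_mem _ _
      | add x y _ _ hx hy => rw [map_add]; exact add_mem hx hy
      | inv x _ hx => rw [map_inv₀]; exact inv_mem hx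
      | mul x y _ _ hx hy => rw [map_mul]; exact mul_mem hx hy
    · apply IntermediateField.adjoin.mono
      apply Set.image_mono
      conv_rhs => rw [hE]
      exact IntermediateField.subset_adjoin _ _
  rw [this]
  exact IntermediateField.adjoin_rootSet_isSplittingField (IsAlgClosed.splits _)

end FieldTheory

section Curves

variable {k : Type u} [Field k]

/-- `s : X ⟶ Spec k` makes `X` a smooth projective connected curve over the algebraically closed
field `k`: it is a complete nonsingular curve, that is, an integral scheme, proper over `k`, all of
whose local rings at closed points are regular of dimension one, i.e. discrete valuation rings.
(Over an algebraically closed field, nonsingular and smooth mean the same, and complete curves are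
projective.) -/
structure IsSmoothProjectiveCurve {X : Scheme.{u}} (s : X ⟶ Spec (.of k)) : Prop where
  [isIntegral : IsIntegral X]
  isProper : IsProper s
  isDiscreteValuationRing : ∀ x : X, IsClosed ({x} : Set X) →
    IsDiscreteValuationRing (X.presheaf.stalk x)

variable (k) in
/-- A smooth projective connected curve over `k`. -/
structure Curve where
  scheme : Scheme.{u}
  str : scheme ⟶ Spec (.of k)
  isCurve : IsSmoothProjectiveCurve str

instance (X : Curve k) : IsIntegral X.scheme := X.isCurve.isIntegral
instance (X : Curve k) : IsProper X.str := X.isCurve.isProper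

/-- The closed points of a curve. -/
abbrev Curve.ClosedPoint (X : Curve k) : Type u := {x : X.scheme // IsClosed ({x} : Set X.scheme)}

instance (X : Curve k) (x : X.ClosedPoint) :
    IsDiscreteValuationRing (X.scheme.presheaf.stalk x.1) :=
  X.isCurve.isDiscreteValuationRing x.1 x.2

/-- The fraction field of the completed local ring of the curve `X` at a closed point `x`. -/
abbrev Curve.localField (X : Curve k) (x : X.ClosedPoint) : Type u :=
  CompletedField (X.scheme.presheaf.stalk x.1)

/-- The function field of a curve. -/
abbrev Curve.functionField (X : Curve k) : Type u := X.scheme.functionField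

/-- A finite generically smooth morphism of curves over `k`. -/
structure Cover (Y X : Curve k) where
  hom : Y.scheme ⟶ X.scheme
  w : hom ≫ X.str = Y.str
  isFinite : IsFinite hom
  genericallySmooth : ∃ U : Y.scheme.Opens, Dense (U : Set Y.scheme) ∧ Smooth (U.ι ≫ hom)

namespace Cover

variable {Y X : Curve k} (f : Cover Y X)

instance : IsFinite f.hom := f.isFinite

/-- A generically smooth morphism of curves is dominant. -/
theorem map_genericPoint : f.hom (genericPoint Y.scheme) = genericPoint X.scheme := by
  obtain ⟨U, hU, hs⟩ := f.genericallySmooth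
  have hne : (U : Set Y.scheme).Nonempty := hU.nonempty
  have hopen : IsOpen (Set.range (U.ι ≫ f.hom)) := (U.ι ≫ f.hom).isOpenMap.isOpen_range
  have hX : genericPoint X.scheme ∈ Set.range (U.ι ≫ f.hom) := by
    refine (genericPoint_spec X.scheme).mem_open_set_iff hopen |>.2 ?_
    obtain ⟨y, hy⟩ := hne
    exact ⟨_, Set.mem_univ _, ⟨y, hy⟩, rfl⟩
  obtain ⟨y, hy⟩ := hX
  have h1 : f.hom (genericPoint Y.scheme) ⤳ genericPoint X.scheme := by
    rw [← hy]
    exact (genericPoint_specializes (U.ι y)).map f.hom.continuous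
  exact (h1.antisymm (genericPoint_specializes _)).eq

/-- The embedding of function fields `k(X) → k(Y)` defined by `f : Y ⟶ X`. -/
def functionFieldMap : X.functionField →+* Y.functionField :=
  (X.scheme.presheaf.stalkSpecializes (specializes_of_eq f.map_genericPoint) ≫
    f.hom.stalkMap (genericPoint Y.scheme)).hom

theorem functionFieldMap_algebraMap (y : Y.scheme)
    (a : X.scheme.presheaf.stalk (f.hom y)) :
    f.functionFieldMap (algebraMap _ X.functionField a) =
      algebraMap _ Y.functionField ((f.hom.stalkMap y).hom a) := by
  have h := Scheme.Hom.stalkSpecializes_stalkMap_apply f.hom _ _ (genericPoint_specializes y) a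
  rw [← TopCat.Presheaf.stalkSpecializes_comp_apply X.scheme.presheaf (specializes_of_eq f.map_genericPoint)
    (genericPoint_specializes (f.hom y))] at h
  exact h

theorem stalkMap_injective (y : Y.scheme) : Function.Injective (f.hom.stalkMap y).hom := by
  intro a b hab
  apply IsFractionRing.injective (X.scheme.presheaf.stalk (f.hom y)) X.functionField
  apply f.functionFieldMap.injective
  rw [functionFieldMap_algebraMap, functionFieldMap_algebraMap, hab]

/-- The image of a closed point. -/
def mapPoint (y : Y.ClosedPoint) : X.ClosedPoint :=
  ⟨f.hom y.1, by
    have := f.hom.isClosedMap _ y.2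
    rwa [Set.image_singleton] at this⟩

/-- The local homomorphism of local rings `𝒪_{X, f(y)} → 𝒪_{Y, y}`. -/
def localRingMap (y : Y.ClosedPoint) :
    X.scheme.presheaf.stalk (f.mapPoint y).1 →+* Y.scheme.presheaf.stalk y.1 :=
  (f.hom.stalkMap y.1).hom

instance (y : Y.ClosedPoint) : IsLocalHom (f.localRingMap y) :=
  inferInstanceAs (IsLocalHom (f.hom.stalkMap y.1).hom)

/-- The embedding of the fraction fields of the completed local rings at `f(y)` and `y`. -/
def localFieldMap (y : Y.ClosedPoint) : X.localField (f.mapPoint y) →+* Y.localField y :=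
  completedFieldMap (f.localRingMap y) (f.stalkMap_injective y.1)

/-- `k(Y)` as an extension of `k(X)`. -/
abbrev functionFieldAlgebra : Algebra X.functionField Y.functionField :=
  f.functionFieldMap.toAlgebra

/-- The group of automorphisms of `k(Y)` over `k(X)`. -/
abbrev GaloisGroup : Type u :=
  letI := f.functionFieldAlgebra
  Gal(Y.functionField/X.functionField)

/-- `f : Y ⟶ X` is Galois: `k(Y)` is a Galois extension of `k(X)`. Its Galois group is then
`f.GaloisGroup`. -/
def IsGaloisCover : Prop :=
  letI := f.functionFieldAlgebra
  IsGalois X.functionField Y.functionField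

end Cover

/-- A branch data on `X`: a finite Galois extension of the fraction field of the completed local
ring at each closed point (inside a fixed algebraic closure), trivial at all but finitely many
points. -/
structure BranchData (X : Curve k) where
  field : ∀ x : X.ClosedPoint,
    IntermediateField (X.localField x) (AlgebraicClosure (X.localField x))
  finiteDimensional : ∀ x, FiniteDimensional (X.localField x) (field x)
  isGalois : ∀ x, IsGalois (X.localField x) (field x)
  finite_support : {x | field x ≠ ⊥}.Finite

/-- The trivial branch data `O`. -/
def BranchData.trivial (X : Curve k) : BranchData X where
  field _ := ⊥
  finiteDimensional _ := inferInstance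
  isGalois _ := inferInstance
  finite_support := by simp

theorem Cover.finite_fiber {Y X : Curve k} (f : Cover Y X) (x : X.ClosedPoint) :
    {y | f.mapPoint y = x}.Finite := by
  refine Set.Finite.of_finite_image (f := Subtype.val) ?_ Subtype.val_injective.injOn
  refine (f.hom.finite_preimage_singleton x.1).subset ?_
  rintro _ ⟨y, rfl, rfl⟩
  rfl

/-- The branch data `f^*P` on `Y`, with `f^*P(y)` the compositum of `P(f(y))` and the local field of
`Y` at `y`. -/
def BranchData.pullback {Y X : Curve k} (f : Cover Y X) (P : BranchData X) : BranchData Y where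
  field y := compositum (f.localFieldMap y) (P.field (f.mapPoint y))
  finiteDimensional y := by
    have := P.finiteDimensional (f.mapPoint y)
    have := P.isGalois (f.mapPoint y)
    obtain ⟨p, -, hp⟩ := exists_compositum_isSplittingField (f.localFieldMap y)
      (P.field (f.mapPoint y))
    exact hp.finiteDimensional _ p
  isGalois y := by
    have := P.finiteDimensional (f.mapPoint y)
    have := P.isGalois (f.mapPoint y)
    obtain ⟨p, hs, hp⟩ := exists_compositum_isSplittingField (f.localFieldMap y)
      (P.field (f.mapPoint y))
    exact IsGalois.of_separable_splitting_field hs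
  finite_support := by
    refine (P.finite_support.biUnion fun x _ ↦ f.finite_fiber x).subset fun y hy ↦ ?_
    simp only [Set.mem_iUnion]
    refine ⟨f.mapPoint y, fun h ↦ hy ?_, rfl⟩
    rw [h, compositum_bot]

section Orbifolds

variable {Y X : Curve k} (f : Cover Y X) (Q : BranchData Y) (P : BranchData X)

/-- `f : (Y, Q) ⟶ (X, P)` is a morphism of formal orbifold curves: `P(f(y)) ⊆ Q(y)` for every
closed point `y` of `Y`. -/
def IsOrbifoldMorphism : Prop :=
  ∀ y : Y.ClosedPoint, transport (f.localFieldMap y) (P.field (f.mapPoint y)) ⊆ Q.field y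

/-- `f : (Y, Q) ⟶ (X, P)` is an étale morphism of formal orbifold curves: `P(f(y)) = Q(y)` for every
closed point `y` of `Y` (so the local field of `Y` at `y` is contained in `P(f(y))`). -/
def IsEtale : Prop :=
  ∀ y : Y.ClosedPoint, transport (f.localFieldMap y) (P.field (f.mapPoint y)) = Q.field y

/-- `f : (Y, f^*P) ⟶ (X, P)` is genuinely ramified: in every factorization
`(Y, f^*P) ⟶ (Z, Q) ⟶ (X, P)` whose second map is an étale cover of formal orbifold curves, that
cover is trivial, i.e. an isomorphism of curves. -/
def IsGenuinelyRamified : Prop :=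
  ∀ (Z : Curve k) (Q : BranchData Z) (a : Cover Y Z) (b : Cover Z X), a.hom ≫ b.hom = f.hom →
    IsOrbifoldMorphism a (P.pullback f) Q → IsEtale b Q P → IsIso b.hom

end Orbifolds

end Curves

section Normalization

/-- The morphism to `S` from the disjoint union of the spectra of the residue fields of the generic
points of the irreducible components of `S`. -/
def genericPointsHom (S : Scheme.{u}) :
    (∐ fun η : genericPoints S ↦ Spec (S.residueField η.1)) ⟶ S :=
  Sigma.desc fun η ↦ S.fromSpecResidueField η.1

instance (S : Scheme.{u}) [IsNoetherian S] : Finite (genericPoints S) :=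
  genericPoints.finite finite_irreducibleComponents_of_isNoetherian

/-- The normalization of a noetherian scheme `S`: the relative normalization of `S` in the disjoint
union of the spectra of the residue fields of its generic points. -/
def normalization (S : Scheme.{u}) [IsNoetherian S] : Scheme.{u} :=
  (genericPointsHom S).normalization

/-- The normalization morphism. -/
def normalizationHom (S : Scheme.{u}) [IsNoetherian S] : normalization S ⟶ S :=
  (genericPointsHom S).fromNormalization

variable {k : Type u} [Field k] {W Y X : Curve k} (p : Cover W X) (f : Cover Y X)

instance : IsNoetherian (pullback p.hom f.hom) := by
  have : IsLocallyNoetherian W.scheme := LocallyOfFiniteType.isLocallyNoetherian W.str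
  have : CompactSpace W.scheme := QuasiCompact.compactSpace_of_compactSpace W.str
  have : CompactSpace (pullback p.hom f.hom : Scheme.{u}) :=
    QuasiCompact.compactSpace_of_compactSpace (pullback.fst p.hom f.hom)
  exact {}

/-- The normalization of the fiber product of `p : W ⟶ X` and `f : Y ⟶ X`. -/
def normalizedFiberProduct : Scheme.{u} :=
  normalization (pullback p.hom f.hom)

/-- The projection of the normalized fiber product to `W`. -/
def normalizedFiberProductFst : normalizedFiberProduct p f ⟶ W.scheme :=
  normalizationHom (pullback p.hom f.hom) ≫ pullback.fst p.hom f.hom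

/-- The projection of the normalized fiber product to `Y`. -/
def normalizedFiberProductSnd : normalizedFiberProduct p f ⟶ Y.scheme :=
  normalizationHom (pullback p.hom f.hom) ≫ pullback.snd p.hom f.hom

/-- The structure morphism of the normalized fiber product. -/
def normalizedFiberProductStr : normalizedFiberProduct p f ⟶ Spec (.of k) :=
  normalizedFiberProductFst p f ≫ W.str

end Normalization

end

end FormalOrbifold

open FormalOrbifold

/-! The proof takes place in function fields. For a cover `c` from `C` to `X`, let T(C) be the field
of functions on `C` whose image in the local field at every closed point z lies in P(c(z)); this is
`Cover.splitField`. A local field is generated by a local field of the base together with the global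
functions (`Cover.subfield_localField_eq_top`). Hence an intermediate curve D of C over X with k(D)
inside T(C) has all its local fields inside P, so it is étale over (X, P) for the pulled-back branch
data. If k(D) also embeds in k(Y) over k(X), genuine ramification of `f` forces D = X. This is
`IsGenuinelyRamified.surjective`, and the whole argument rests on it.

Since W is étale over (X, P), T(W) = k(W). So no nontrivial subextension of k(Y) embeds in k(W), and
because k(W)/k(X) is Galois, k(Y) ⊗ k(W) is a field F (`isField_tensorProduct`). Covers of curves
are flat, so generic points of the fiber product lie over the generic points of both factors; there
is only one, with residue field F. The normalization is thus that of Y in F, which is a curve with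
function field F because F/k(Y) is finite separable.

Now put T = T(Z). It contains k(W), and T ∩ k(Y) = k(X) by the key statement. In particular k(W) ∩
k(Y) = k(X), so restriction identifies Gal(k(Z)/k(Y)) with Γ (`exists_mulEquiv_of_compositum`). The
map q is étale because k(Z) is the compositum of k(W) and k(Y): its local fields lie in f^*P, and P
is already attained on W (`isEtale_of_compositum`).

For g, let V be an étale cover of (W, O) between Z and W. It is étale over (X, P), so k(V) lies in
T. The group G = Gal(k(Z)/k(Y)) preserves T, with fixed field T ∩ k(Y) = k(X), so Artin's bound
gives [T : k(X)] ≤ |G| ≤ [k(W) : k(X)]. Therefore T = k(W) and V = W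
(`mem_range_algebraMap_of_stable`, `IsGenuinelyRamified.of_compositum`). -/

namespace FormalOrbifold

/-! ### Transporting normal extensions between algebraic closures. -/

section Transport

variable {K L M : Type u} [Field K] [Field L] [Field M]

/-- The minimal polynomial of an element of E splits in E, so each of its roots in Ω is the image
under `τ'` of an element of E. The image of that element under `τ` is such a root. -/
theorem image_eq_image_of_comp_algebraMap_eq {Ω : Type*} [Field Ω]
    (E : IntermediateField K (AlgebraicClosure K)) [Normal K E]
    (τ τ' : AlgebraicClosure K →+* Ω)
    (h : τ.comp (algebraMap K _) = τ'.comp (algebraMap K _)) :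
    τ '' (E : Set (AlgebraicClosure K)) = τ' '' E := by
  suffices key : ∀ τ τ' : AlgebraicClosure K →+* Ω,
      τ.comp (algebraMap K _) = τ'.comp (algebraMap K _) →
      τ '' (E : Set (AlgebraicClosure K)) ⊆ τ' '' E from
    (key τ τ' h).antisymm (key τ' τ h.symm)
  rintro τ τ' h _ ⟨x, hx, rfl⟩
  have hint : IsIntegral K (⟨x, hx⟩ : E) := Normal.isIntegral inferInstance _
  have hspl := Normal.splits (F := K) (K := E) inferInstance ⟨x, hx⟩
  have hroots := hspl.roots_map (τ'.comp (algebraMap E (AlgebraicClosure K)))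
  rw [Polynomial.map_map] at hroots
  have hcomp : (τ'.comp (algebraMap E (AlgebraicClosure K))).comp (algebraMap K E) =
      τ.comp (algebraMap K _) := by rw [h]; rfl
  rw [hcomp] at hroots
  have hmem : τ x ∈ ((minpoly K (⟨x, hx⟩ : E)).map (τ.comp (algebraMap K _))).roots := by
    have h0 : Polynomial.aeval (algebraMap E (AlgebraicClosure K) ⟨x, hx⟩)
        (minpoly K (⟨x, hx⟩ : E)) = 0 := by
      rw [Polynomial.aeval_algebraMap_apply, minpoly.aeval, map_zero]
    rw [Polynomial.mem_roots_map (minpoly.ne_zero hint), ← Polynomial.hom_eval₂]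
    exact (congrArg τ h0).trans (map_zero τ)
  rw [hroots, Multiset.mem_map] at hmem
  obtain ⟨y, -, hy⟩ := hmem
  exact ⟨y, y.2, hy⟩

/-- The extensions `algClosureMap` are chosen, so they do not compose; normality of E makes the
choice irrelevant for images. -/
theorem transport_comp (φ : K →+* L) (ψ : L →+* M)
    (E : IntermediateField K (AlgebraicClosure K)) [Normal K E] :
    transport (ψ.comp φ) E = algClosureMap ψ '' transport φ E := by
  rw [transport, transport, ← Set.image_comp, ← RingHom.coe_comp]
  refine image_eq_image_of_comp_algebraMap_eq E _ _ (RingHom.ext fun x ↦ ?_)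
  simp [algClosureMap_algebraMap]

theorem algebraMap_mem_transport (φ : K →+* L) (E : IntermediateField K (AlgebraicClosure K))
    (x : K) : algebraMap L (AlgebraicClosure L) (φ x) ∈ transport φ E :=
  ⟨algebraMap K _ x, E.algebraMap_mem x, algClosureMap_algebraMap φ x⟩

/-- The elements of `L` that lie in the transport of `E`. -/
noncomputable def transportSubfield (φ : K →+* L) (E : IntermediateField K (AlgebraicClosure K)) :
    Subfield L :=
  (E.toSubfield.map (algClosureMap φ)).comap (algebraMap L (AlgebraicClosure L))

theorem mem_transportSubfield {φ : K →+* L} {E : IntermediateField K (AlgebraicClosure K)} {x : L} :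
    x ∈ transportSubfield φ E ↔ algebraMap L (AlgebraicClosure L) x ∈ transport φ E :=
  Iff.rfl

theorem map_mem_transportSubfield_comp (φ : K →+* L) (ψ : L →+* M)
    (E : IntermediateField K (AlgebraicClosure K)) [Normal K E] {x : L} :
    ψ x ∈ transportSubfield (ψ.comp φ) E ↔ x ∈ transportSubfield φ E := by
  rw [mem_transportSubfield, mem_transportSubfield, transport_comp, ← algClosureMap_algebraMap,
    (algClosureMap ψ).injective.mem_set_image]

theorem transport_subset_compositum (φ : K →+* L) (E : IntermediateField K (AlgebraicClosure K)) :
    transport φ E ⊆ compositum φ E :=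
  IntermediateField.subset_adjoin _ _

/-- Once the transport contains L it is itself a field over L, so adjoining it to L adds nothing. -/
theorem transport_eq_compositum {φ : K →+* L} {E : IntermediateField K (AlgebraicClosure K)}
    (h : transportSubfield φ E = ⊤) : transport φ E = compositum φ E := by
  refine (transport_subset_compositum φ E).antisymm ?_
  let F : IntermediateField L (AlgebraicClosure L) :=
    (E.toSubfield.map (algClosureMap φ)).toIntermediateField fun x ↦ by
      have : x ∈ transportSubfield φ E := h ▸ Subfield.mem_top x
      exact this
  exact (IntermediateField.adjoin_le_iff (T := F)).mpr subset_rfl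

/-- The preimage of F is a field containing L, because `algClosureMap ψ` extends `ψ`; so containment
need only be checked on generators of the compositum. -/
theorem algClosureMap_image_compositum_subset (φ : K →+* L) (ψ : L →+* M)
    (E : IntermediateField K (AlgebraicClosure K)) (F : IntermediateField M (AlgebraicClosure M))
    (h : algClosureMap ψ '' transport φ E ⊆ F) :
    algClosureMap ψ '' (compositum φ E : Set (AlgebraicClosure L)) ⊆ F := by
  let G : IntermediateField L (AlgebraicClosure L) :=
    (F.toSubfield.comap (algClosureMap ψ)).toIntermediateField fun x ↦ by
      change algClosureMap ψ _ ∈ F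
      rw [algClosureMap_algebraMap]
      exact F.algebraMap_mem _
  rw [Set.image_subset_iff] at h ⊢
  exact (IntermediateField.adjoin_le_iff (T := G)).mpr h

end Transport

/-! ### Generators of the completed local ring over that of the base. -/

section Completion

variable {R S : Type u} [CommRing R] [IsDomain R] [IsDiscreteValuationRing R]
  [CommRing S] [IsDomain S] [IsDiscreteValuationRing S]

theorem exists_sub_algebraMap_mem (a : Completion S) (n : ℕ) :
    ∃ s : S, a - algebraMap S (Completion S) s ∈ maximalIdeal (Completion S) ^ n := by
  obtain ⟨s, hs⟩ := Ideal.Quotient.mk_surjective (AdicCompletion.evalₐ (maximalIdeal S) n a)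
  refine ⟨s, ?_⟩
  have h0 : a - algebraMap S (Completion S) s ∈ (AdicCompletion.eval (maximalIdeal S) S n).ker := by
    have h1 : AdicCompletion.evalₐ (maximalIdeal S) n (a - algebraMap S (Completion S) s) = 0 := by
      rw [map_sub, ← hs, AlgHom.commutes]
      simp
    rw [LinearMap.mem_ker, ← AdicCompletion.factor_evalₐ_eq_eval _ _ (by simp), h1, map_zero]
  rw [← AdicCompletion.pow_smul_top_eq_ker_eval (maximalIdeal S).fg_of_isNoetherianRing,
    Ideal.smul_top_eq_map, Ideal.map_pow, Submodule.restrictScalars_mem] at h0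
  rwa [AdicCompletion.maximalIdeal_eq_map]

theorem isPrecomplete_pi {A : Type*} [CommRing A] (I : Ideal A) [IsPrecomplete I A]
    {ι : Type*} [Finite ι] : IsPrecomplete I (ι → A) := by
  have := Fintype.ofFinite ι
  classical
  rw [← AdicCompletion.of_surjective_iff]
  intro x
  choose y hy using fun i ↦ AdicCompletion.of_surjective I A (AdicCompletion.pi I _ x i)
  refine ⟨y, (AdicCompletion.piEquivOfFintype I (fun _ : ι ↦ A)).injective ?_⟩
  rw [AdicCompletion.piEquivOfFintype_apply, AdicCompletion.piEquivOfFintype_apply]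
  funext i
  rw [← hy i]
  exact AdicCompletion.map_of I _ _

/-- If finitely many elements span `S` over `R` modulo all powers of the maximal ideal of `S`, then
they span the completion of `S` over the completion of `R`. -/
theorem exists_eq_sum_completionMap (φ : R →+* S) [IsLocalHom φ] (hφ : Function.Injective φ)
    {ι : Type*} [Fintype ι] (b : ι → S)
    (hb : ∀ (n : ℕ) (s : S), ∃ r : ι → R, s - ∑ i, φ (r i) * b i ∈ maximalIdeal S ^ n)
    (a : Completion S) : ∃ r : ι → Completion R,
      ∑ i, completionMap φ (r i) * algebraMap S (Completion S) (b i) = a := by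
  classical
  let := (completionMap φ).toAlgebra
  let I := maximalIdeal (Completion R)
  have hI : I.map (algebraMap (Completion R) (Completion S)) ≤ maximalIdeal (Completion S) := by
    simp only [I]
    rw [AdicCompletion.maximalIdeal_eq_map, Ideal.map_map, Ideal.map_le_iff_le_comap]
    intro r hr
    rw [Ideal.mem_comap, RingHom.comp_apply]
    change completionMap φ (algebraMap R (Completion R) r) ∈ _
    rw [completionMap_algebraMap, AdicCompletion.maximalIdeal_eq_map]
    have h : (maximalIdeal R).map φ ≤ maximalIdeal S :=
      ((local_hom_TFAE φ).out 0 2).mp ‹IsLocalHom φ›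
    exact Ideal.mem_map_of_mem _ (h (Ideal.mem_map_of_mem _ hr))
  have hpow (n : ℕ) : ∀ x ∈ (I ^ n • ⊤ : Submodule (Completion R) (Completion S)),
      x ∈ maximalIdeal (Completion S) ^ n := by
    intro x hx
    rw [Ideal.smul_top_eq_map, Submodule.restrictScalars_mem, Ideal.map_pow] at hx
    exact Ideal.pow_right_mono hI n hx
  have : IsHausdorff I (Completion S) := ⟨fun x hx ↦ by
    refine IsHausdorff.haus (I := maximalIdeal (Completion S)) inferInstance x fun n ↦ ?_
    rw [SModEq.zero, smul_eq_mul, Ideal.mul_top]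
    exact hpow n x (SModEq.zero.mp (hx n))⟩
  have : IsPrecomplete I (ι → Completion R) := isPrecomplete_pi I
  let f : (ι → Completion R) →ₗ[Completion R] Completion S :=
    Fintype.linearCombination (Completion R) fun i ↦ algebraMap S (Completion S) (b i)
  have hf (r) : f r = ∑ i, completionMap φ (r i) * algebraMap S (Completion S) (b i) := by
    simp [f, Fintype.linearCombination_apply, Algebra.smul_def, RingHom.algebraMap_toAlgebra]
  obtain ⟨ϖ, hϖ⟩ := IsDiscreteValuationRing.exists_irreducible R
  obtain ⟨π, hπ⟩ := IsDiscreteValuationRing.exists_irreducible S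
  have hϖ0 : completionMap φ (algebraMap R _ ϖ) ≠ 0 := by
    rw [completionMap_algebraMap]
    simpa [map_eq_zero_iff _ (algebraMap_completion_injective (R := S)), map_eq_zero_iff _ hφ]
      using hϖ.ne_zero
  -- N is the ramification index: a uniformizer of R is a unit times π^N. So the N-th power of the
  -- maximal ideal upstairs lies in the ideal extended from below.
  obtain ⟨N, v, hv, hN⟩ := completion_eq_unit_mul_pow hπ hϖ0
  have hle (x) (hx : x ∈ maximalIdeal (Completion S) ^ N) :
      x ∈ (I • ⊤ : Submodule (Completion R) (Completion S)) := by
    rw [Ideal.smul_top_eq_map, Submodule.restrictScalars_mem]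
    have hmax : maximalIdeal (Completion S) = Ideal.span {algebraMap S (Completion S) π} := by
      have h {T : Type u} [CommRing T] (f : S →+* T) :
          (maximalIdeal S).map f = Ideal.span {f π} := by
        rw [hπ.maximalIdeal_eq, Ideal.map_span, Set.image_singleton]
      rw [AdicCompletion.maximalIdeal_eq_map, h]
    rw [hmax, Ideal.span_singleton_pow, Ideal.mem_span_singleton] at hx
    obtain ⟨c, rfl⟩ := hx
    refine Ideal.mul_mem_right _ _ ?_
    rw [← Ideal.unit_mul_mem_iff_mem _ hv, ← hN]
    refine Ideal.mem_map_of_mem _ ?_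
    simp only [I]
    rw [AdicCompletion.maximalIdeal_eq_map]
    exact Ideal.mem_map_of_mem _ ((mem_maximalIdeal _).mpr hϖ.not_isUnit)
  -- Nakayama for complete modules: the source is precomplete and the target separated for I, so
  -- surjectivity modulo I suffices. Modulo I, approximation to order N is enough.
  suffices hs : Function.Surjective ((I • ⊤ : Submodule (Completion R) (Completion S)).mkQ ∘ₗ f) by
    obtain ⟨r, hr⟩ := surjective_of_mkQ_comp_surjective hs a
    exact ⟨r, by rw [← hf, hr]⟩
  intro y
  obtain ⟨x, rfl⟩ := Submodule.mkQ_surjective _ y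
  obtain ⟨s, hs⟩ := exists_sub_algebraMap_mem x N
  obtain ⟨r, hr⟩ := hb N s
  refine ⟨fun i ↦ algebraMap R _ (r i), ?_⟩
  rw [LinearMap.comp_apply, hf, eq_comm, ← sub_eq_zero, ← map_sub, Submodule.mkQ_apply,
    Submodule.Quotient.mk_eq_zero]
  apply hle
  have hr' := Ideal.mem_map_of_mem (algebraMap S (Completion S)) hr
  rw [Ideal.map_pow, ← AdicCompletion.maximalIdeal_eq_map] at hr'
  convert add_mem hs hr' using 1
  simp [completionMap_algebraMap]

/-- If `S` is spanned by finitely many elements over `R` modulo all powers of its maximal ideal,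
then the completed fraction field of `S` is generated by `S` and the completed fraction field of
`R`. -/
theorem subfield_completedField_eq_top (φ : R →+* S) [IsLocalHom φ] (hφ : Function.Injective φ)
    {ι : Type*} [Fintype ι] (b : ι → S)
    (hb : ∀ (n : ℕ) (s : S), ∃ r : ι → R, s - ∑ i, φ (r i) * b i ∈ maximalIdeal S ^ n)
    (T : Subfield (CompletedField S)) (hT : ∀ x, completedFieldMap φ hφ x ∈ T)
    (hS : ∀ s : S, algebraMap (Completion S) (CompletedField S) (algebraMap S _ s) ∈ T) :
    T = ⊤ := by
  have h (a : Completion S) : algebraMap (Completion S) (CompletedField S) a ∈ T := by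
    obtain ⟨r, rfl⟩ := exists_eq_sum_completionMap φ hφ b hb a
    rw [map_sum]
    refine sum_mem fun i _ ↦ ?_
    rw [map_mul]
    refine mul_mem ?_ (hS _)
    have := hT (algebraMap _ _ (r i))
    rwa [completedFieldMap, IsFractionRing.map, IsLocalization.map_eq] at this
  rw [eq_top_iff]
  intro x _
  obtain ⟨a, s, -, rfl⟩ := IsFractionRing.div_surjective (A := Completion S) x
  exact div_mem (h a) (h s)

end Completion

/-! ### Functoriality of completions and completed fields. -/

section CompletionMap

variable {R S T : Type u} [CommRing R] [IsDomain R] [IsDiscreteValuationRing R]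
  [CommRing S] [IsDomain S] [IsDiscreteValuationRing S]
  [CommRing T] [IsDomain T] [IsDiscreteValuationRing T]

theorem completionMap_comp (φ : R →+* S) [IsLocalHom φ] (ψ : S →+* T) [IsLocalHom ψ]
    [IsLocalHom (ψ.comp φ)] :
    completionMap (ψ.comp φ) = (completionMap ψ).comp (completionMap φ) := by
  refine RingHom.ext fun x ↦ AdicCompletion.ext_evalₐ fun n ↦ ?_
  rw [RingHom.comp_apply, completionMap, completionMap, AdicCompletion.evalₐ_liftRingHom,
    AdicCompletion.evalₐ_liftRingHom]
  simp only [truncationMap, RingHom.comp_apply]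
  change _ = Ideal.quotientMap _ ψ _ (AdicCompletion.evalₐ (maximalIdeal S) n (completionMap φ x))
  rw [completionMap, AdicCompletion.evalₐ_liftRingHom]
  obtain ⟨r, rfl⟩ := AdicCompletion.mk_surjective _ _ x
  simp [truncationMap]

theorem completedFieldMap_algebraMap (φ : R →+* S) [IsLocalHom φ] (hφ : Function.Injective φ)
    (a : Completion R) :
    completedFieldMap φ hφ (algebraMap _ _ a) = algebraMap _ _ (completionMap φ a) := by
  rw [completedFieldMap, IsFractionRing.map, IsLocalization.map_eq]

theorem completedFieldMap_comp (φ : R →+* S) [IsLocalHom φ] (ψ : S →+* T) [IsLocalHom ψ]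
    [IsLocalHom (ψ.comp φ)] (hφ : Function.Injective φ) (hψ : Function.Injective ψ)
    (h : Function.Injective (ψ.comp φ)) :
    completedFieldMap (ψ.comp φ) h = (completedFieldMap ψ hψ).comp (completedFieldMap φ hφ) := by
  refine IsLocalization.ringHom_ext (nonZeroDivisors (Completion R)) (RingHom.ext fun x ↦ ?_)
  simp [completedFieldMap, IsFractionRing.map, IsLocalization.map_eq, completionMap_comp]

end CompletionMap

/-! ### Composition of covers, local fields and the split field. -/

section Covers

variable {k : Type u} [Field k] {X Y Z : Curve k}

theorem Cover.ext {f g : Cover Y X} (h : f.hom = g.hom) : f = g := by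
  cases f; cases g; cases h; rfl

/-- The composition of two covers, given that it is generically smooth. -/
def Cover.comp (a : Cover Z Y) (b : Cover Y X)
    (h : ∃ U : Z.scheme.Opens, Dense (U : Set Z.scheme) ∧ Smooth (U.ι ≫ a.hom ≫ b.hom)) :
    Cover Z X where
  hom := a.hom ≫ b.hom
  w := by rw [Category.assoc, b.w, a.w]
  isFinite := inferInstance
  genericallySmooth := h

variable (a : Cover Z Y) (b : Cover Y X)
    (h : ∃ U : Z.scheme.Opens, Dense (U : Set Z.scheme) ∧ Smooth (U.ι ≫ a.hom ≫ b.hom))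

theorem Cover.comp_localRingMap (z : Z.ClosedPoint) :
    (a.comp b h).localRingMap z = (a.localRingMap z).comp (b.localRingMap (a.mapPoint z)) :=
  congrArg CommRingCat.Hom.hom (Scheme.Hom.stalkMap_comp a.hom b.hom z.1)

theorem completedFieldMap_congr {R S : Type u} [CommRing R] [IsDomain R] [IsDiscreteValuationRing R]
  [CommRing S] [IsDomain S] [IsDiscreteValuationRing S] {φ ψ : R →+* S} (_ : IsLocalHom φ)
    (_ : IsLocalHom ψ) (h : φ = ψ) (hφ : Function.Injective φ) (hψ : Function.Injective ψ) :
   completedFieldMap φ hφ = completedFieldMap ψ hψ := by subst h; rfl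

theorem Cover.comp_localFieldMap (z : Z.ClosedPoint) :
    (a.comp b h).localFieldMap z = (a.localFieldMap z).comp (b.localFieldMap (a.mapPoint z)) := by
  have hloc : IsLocalHom ((a.localRingMap z).comp (b.localRingMap (a.mapPoint z))) :=
    RingHom.isLocalHom_comp _ _
  have hinj : Function.Injective ((a.localRingMap z).comp (b.localRingMap (a.mapPoint z))) :=
    (a.stalkMap_injective z.1).comp (b.stalkMap_injective (a.mapPoint z).1)
  have hloc' : IsLocalHom (R := X.scheme.presheaf.stalk (b.mapPoint (a.mapPoint z)).1)
      ((a.comp b h).localRingMap z) :=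
    inferInstanceAs (IsLocalHom ((a.comp b h).hom.stalkMap z.1).hom)
  exact (completedFieldMap_congr (R := X.scheme.presheaf.stalk (b.mapPoint (a.mapPoint z)).1)
    (ψ := (a.localRingMap z).comp (b.localRingMap (a.mapPoint z)))
    hloc' hloc (a.comp_localRingMap b h z) ((a.comp b h).stalkMap_injective z.1)
    hinj).trans (completedFieldMap_comp _ _ _ _ _)

/-- The function field of a curve embeds in each of its local fields. -/
noncomputable def Curve.toLocalField (X : Curve k) (x : X.ClosedPoint) :
    X.functionField →+* X.localField x :=
  IsFractionRing.lift (A := X.scheme.presheaf.stalk x.1)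
    (g := (algebraMap (Completion (X.scheme.presheaf.stalk x.1)) (X.localField x)).comp
      (algebraMap _ _))
    ((IsFractionRing.injective (Completion (X.scheme.presheaf.stalk x.1)) (X.localField x)).comp
      algebraMap_completion_injective)

theorem Curve.toLocalField_algebraMap (x : X.ClosedPoint) (s : X.scheme.presheaf.stalk x.1) :
    X.toLocalField x (algebraMap _ _ s) =
      algebraMap (Completion (X.scheme.presheaf.stalk x.1)) (X.localField x) (algebraMap _ _ s) :=
  IsFractionRing.lift_algebraMap (A := X.scheme.presheaf.stalk x.1) _ _

theorem Cover.toLocalField_functionFieldMap (y : Y.ClosedPoint) (t : X.functionField) :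
    Y.toLocalField y (b.functionFieldMap t) =
      b.localFieldMap y (X.toLocalField (b.mapPoint y) t) := by
  obtain ⟨r, s, -, rfl⟩ :=
    IsFractionRing.div_surjective (A := X.scheme.presheaf.stalk (b.mapPoint y).1) t
  have key (r : X.scheme.presheaf.stalk (b.mapPoint y).1) :
      Y.toLocalField y (b.functionFieldMap (algebraMap _ _ r)) =
        b.localFieldMap y (X.toLocalField (b.mapPoint y) (algebraMap _ _ r)) := by
    have h : b.localFieldMap y (algebraMap (Completion (X.scheme.presheaf.stalk (b.mapPoint y).1))
        (X.localField (b.mapPoint y)) (algebraMap _ _ r)) = _ :=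
      completedFieldMap_algebraMap (b.localRingMap y) _ _
    rw [Curve.toLocalField_algebraMap, h, completionMap_algebraMap,
      ← Curve.toLocalField_algebraMap]
    exact congrArg _ (b.functionFieldMap_algebraMap y.1 r)
  simp only [map_div₀, key]

theorem Cover.functionFieldMap_comp :
    (a.comp b h).functionFieldMap = a.functionFieldMap.comp b.functionFieldMap := by
  ext t
  obtain ⟨r, s, -, rfl⟩ := IsFractionRing.div_surjective (A := X.scheme.presheaf.stalk
    ((a.comp b h).hom (genericPoint Z.scheme))) t
  have key (r : X.scheme.presheaf.stalk ((a.comp b h).hom (genericPoint Z.scheme))) :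
      (a.comp b h).functionFieldMap (algebraMap _ _ r) =
        a.functionFieldMap (b.functionFieldMap (algebraMap _ _ r)) := by
    rw [functionFieldMap_algebraMap]
    refine Eq.trans ?_ (congrArg _ (b.functionFieldMap_algebraMap (a.hom _) r)).symm
    rw [functionFieldMap_algebraMap]
    exact congrArg _ (congrArg (fun f ↦ f.hom r) (Scheme.Hom.stalkMap_comp a.hom b.hom _))
  simp only [map_div₀, key, RingHom.comp_apply]

/-- The functions on `Y` whose images in the local fields of `Y` lie in the fields of the branch
data `P` on `X`. -/
noncomputable def Cover.splitField (f : Cover Y X) (P : BranchData X) : Subfield Y.functionField :=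
  ⨅ y : Y.ClosedPoint,
    (transportSubfield (f.localFieldMap y) (P.field (f.mapPoint y))).comap (Y.toLocalField y)

theorem Cover.mem_splitField {f : Cover Y X} {P : BranchData X} {t : Y.functionField} :
    t ∈ f.splitField P ↔ ∀ y : Y.ClosedPoint, Y.toLocalField y t ∈
      transportSubfield (f.localFieldMap y) (P.field (f.mapPoint y)) := by
  rw [splitField, Subfield.mem_iInf]
  rfl

/-- Membership in P can be tested after enlarging the local field. This lets information about a
curve be read off on any cover of it. -/
theorem Cover.localFieldMap_mem_transportSubfield (P : BranchData X) (z : Z.ClosedPoint)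
    {t : Y.localField (a.mapPoint z)} :
    a.localFieldMap z t ∈ transportSubfield ((a.comp b h).localFieldMap z)
        (P.field ((a.comp b h).mapPoint z)) ↔
      t ∈ transportSubfield (b.localFieldMap (a.mapPoint z))
        (P.field (b.mapPoint (a.mapPoint z))) := by
  have := P.isGalois (b.mapPoint (a.mapPoint z))
  rw [comp_localFieldMap]
  exact map_mem_transportSubfield_comp (b.localFieldMap (a.mapPoint z)) (a.localFieldMap z)
    (P.field (b.mapPoint (a.mapPoint z)))

/-- The condition at z is the condition at a(z). It follows that the split field is preserved by
automorphisms over X and contains the function field of each intermediate curve étale over (X, P).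
-/
theorem Cover.functionFieldMap_mem_splitField (P : BranchData X) {t : Y.functionField}
    (ht : t ∈ b.splitField P) : a.functionFieldMap t ∈ (a.comp b h).splitField P := by
  rw [mem_splitField] at ht ⊢
  intro z
  rw [toLocalField_functionFieldMap, localFieldMap_mem_transportSubfield]
  exact ht _

theorem IsEtale.transportSubfield_eq_top {f : Cover Y X} {Q : BranchData Y} {P : BranchData X}
    (hf : IsEtale f Q P) (y : Y.ClosedPoint) :
    transportSubfield (f.localFieldMap y) (P.field (f.mapPoint y)) = ⊤ := by
  rw [eq_top_iff]
  intro x _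
  rw [mem_transportSubfield, hf y]
  exact (Q.field y).algebraMap_mem x

theorem IsEtale.splitField_eq_top {f : Cover Y X} {Q : BranchData Y} {P : BranchData X}
    (hf : IsEtale f Q P) : f.splitField P = ⊤ := by
  rw [eq_top_iff]
  intro t _
  rw [Cover.mem_splitField]
  intro y
  rw [hf.transportSubfield_eq_top]
  exact Subfield.mem_top _

/-- If P(f(y)) contains the local field at y, the compositum f^*P(y) is P(f(y)) itself. -/
theorem isEtale_pullback {f : Cover Y X} {P : BranchData X}
    (hf : ∀ y, transportSubfield (f.localFieldMap y) (P.field (f.mapPoint y)) = ⊤) :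
    IsEtale f (P.pullback f) P :=
  fun y ↦ transport_eq_compositum (hf y)

theorem transport_comp_localFieldMap (P : BranchData X) (z : Z.ClosedPoint) :
    transport ((a.comp b h).localFieldMap z) (P.field ((a.comp b h).mapPoint z)) =
      algClosureMap (a.localFieldMap z) ''
        transport (b.localFieldMap (a.mapPoint z)) (P.field (b.mapPoint (a.mapPoint z))) := by
  have := P.isGalois (b.mapPoint (a.mapPoint z))
  rw [Cover.comp_localFieldMap]
  exact transport_comp (b.localFieldMap (a.mapPoint z)) (a.localFieldMap z)
    (P.field (b.mapPoint (a.mapPoint z)))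

theorem isOrbifoldMorphism_pullback (P : BranchData X) :
    IsOrbifoldMorphism a (P.pullback (a.comp b h)) (P.pullback b) := by
  intro z
  refine algClosureMap_image_compositum_subset (b.localFieldMap (a.mapPoint z)) _
    (P.field (b.mapPoint (a.mapPoint z))) _ ?_
  rw [← transport_comp_localFieldMap a b h]
  exact transport_subset_compositum _ _

/-- The intermediate curve is given the branch data b^*P, for which the first map is always a
morphism of orbifold curves. -/
theorem IsGenuinelyRamified.isIso {P : BranchData X} (hf : IsGenuinelyRamified (a.comp b h) P)
    (hb : ∀ y, transportSubfield (b.localFieldMap y) (P.field (b.mapPoint y)) = ⊤) :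
    IsIso b.hom :=
  hf Y (P.pullback b) a b rfl (isOrbifoldMorphism_pullback a b h P) (isEtale_pullback hb)

end Covers

/-! ### A local criterion for Dedekind domains. -/

section Dedekind

/-- A nonzero prime inside a maximal ideal M stays a nonzero prime in the localization at M, where
the only such prime is the maximal one. Integral closedness is local. -/
theorem isDedekindDomain_of_isDiscreteValuationRing {A : Type u} [CommRing A] [IsDomain A]
    [IsNoetherianRing A] (h : ∀ M : Ideal A, ∀ _ : M.IsMaximal,
      IsDiscreteValuationRing (Localization.AtPrime M)) : IsDedekindDomain A := by
  have hdim : Ring.DimensionLEOne A := ⟨fun {P} hP hPp ↦ by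
    obtain ⟨M, hM, hPM⟩ := P.exists_le_maximal hPp.ne_top
    have := h M hM
    have hdisj : Disjoint (M.primeCompl : Set A) (P : Set A) :=
      Set.disjoint_left.mpr fun x hx hxP ↦ hx (hPM hxP)
    have hprime := IsLocalization.isPrime_of_isPrime_disjoint M.primeCompl
      (Localization.AtPrime M) P hPp hdisj
    have hcomap := IsLocalization.under_map_of_isPrime_disjoint M.primeCompl
      (Localization.AtPrime M) hPp hdisj
    have hne : P.map (algebraMap A (Localization.AtPrime M)) ≠ ⊥ := by
      intro h0
      apply hP
      rw [← hcomap, h0, eq_bot_iff]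
      intro x hx
      exact (IsLocalization.injective (Localization.AtPrime M)
        M.primeCompl_le_nonZeroDivisors) ((Ideal.mem_bot.mp hx).trans (map_zero _).symm)
    have hmax : P.map (algebraMap A (Localization.AtPrime M)) =
        maximalIdeal (Localization.AtPrime M) :=
      IsLocalRing.eq_maximalIdeal (hprime.isMaximal hne)
    have hPM' : P = M := by
      rw [← hcomap, hmax]
      exact IsLocalization.AtPrime.under_maximalIdeal (Localization.AtPrime M) M
    exact hPM' ▸ hM⟩
  have hclosed : IsIntegrallyClosed A := IsIntegrallyClosed.of_localization_maximal fun P _ hPm ↦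
    have := h P hPm
    inferInstance
  exact { }

end Dedekind

/-! ### Affine opens of curves, and generation of local fields. -/

section Curves

variable {k : Type u} [Field k]

instance (X : Curve k) : IsLocallyNoetherian X.scheme :=
  LocallyOfFiniteType.isLocallyNoetherian X.str

instance (X : Curve k) : JacobsonSpace X.scheme :=
  LocallyOfFiniteType.jacobsonSpace X.str

theorem Curve.isDedekindDomain (X : Curve k) {U : X.scheme.Opens} (hU : IsAffineOpen U)
    [Nonempty U] : IsDedekindDomain Γ(X.scheme, U) := by
  have : IsNoetherianRing Γ(X.scheme, U) := IsLocallyNoetherian.component_noetherian ⟨U, hU⟩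
  refine isDedekindDomain_of_isDiscreteValuationRing fun M hM ↦ ?_
  let y : PrimeSpectrum Γ(X.scheme, U) := ⟨M, hM.isPrime⟩
  have hyU : hU.fromSpec y ∈ U := by
    rw [← SetLike.mem_coe, ← hU.range_fromSpec]
    exact ⟨y, rfl⟩
  have hclosed : IsClosed {hU.fromSpec y} := by
    have h1 : y ∈ closedPoints (Spec Γ(X.scheme, U)) :=
      (PrimeSpectrum.isClosed_singleton_iff_isMaximal y).mpr hM
    -- The curve is a Jacobson space, so a point closed in an affine open is closed in the curve.
    rw [← hU.fromSpec.isOpenEmbedding.preimage_closedPoints] at h1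
    exact h1
  have := X.isCurve.isDiscreteValuationRing _ hclosed
  let := TopCat.Presheaf.algebra_section_stalk X.scheme.presheaf ⟨hU.fromSpec y, hyU⟩
  have : IsLocalization.AtPrime (X.scheme.presheaf.stalk (hU.fromSpec y)) M :=
    hU.isLocalization_stalk' y hyU
  exact IsDiscreteValuationRing.RingEquivClass.isDiscreteValuationRing
    (IsLocalization.algEquiv M.primeCompl (X.scheme.presheaf.stalk (hU.fromSpec y))
      (Localization.AtPrime M))

/-- The local fields of a cover are generated by its function field and the local fields of the
base. -/
theorem Cover.subfield_localField_eq_top {X Y : Curve k} (f : Cover Y X) (y : Y.ClosedPoint)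
    (T : Subfield (Y.localField y)) (hT : ∀ x, f.localFieldMap y x ∈ T)
    (hY : ∀ t, Y.toLocalField y t ∈ T) : T = ⊤ := by
  obtain ⟨_, ⟨U, hU, rfl⟩, hxU, -⟩ :=
    X.scheme.isBasis_affineOpens.exists_subset_of_mem_open (Set.mem_univ (f.hom y.1)) isOpen_univ
  have hV : IsAffineOpen (f.hom ⁻¹ᵁ U) := hU.preimage f.hom
  have hfin : (f.hom.app U).hom.Finite := f.hom.finite_app U hU
  let := (f.hom.app U).hom.toAlgebra
  have : Module.Finite Γ(X.scheme, U) Γ(Y.scheme, f.hom ⁻¹ᵁ U) := hfin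
  obtain ⟨m, b, hb⟩ := Module.Finite.exists_fin (R := Γ(X.scheme, U))
    (M := Γ(Y.scheme, f.hom ⁻¹ᵁ U))
  let := TopCat.Presheaf.algebra_section_stalk Y.scheme.presheaf
    (⟨y.1, hxU⟩ : (f.hom ⁻¹ᵁ U : Y.scheme.Opens))
  have hloc := hV.isLocalization_stalk ⟨y.1, hxU⟩
  have hmax := hV.primeIdealOf_isMaximal_of_isClosed ⟨y.1, hxU⟩ y.2
  refine subfield_completedField_eq_top (f.localRingMap y) (f.stalkMap_injective y.1)
    (fun i ↦ Y.scheme.presheaf.germ (f.hom ⁻¹ᵁ U) y.1 hxU (b i)) (fun n s ↦ ?_) T hT fun s ↦ ?_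
  · let p := (hV.primeIdealOf ⟨y.1, hxU⟩).asIdeal
    -- The stalk at y need not be finite over the stalk at f(y), as other points may lie over f(y).
    -- But modulo each power of the maximal ideal it is a quotient of the sections over the preimage
    -- of U, which are finite over those over U.
    obtain ⟨t, ht⟩ := (IsLocalization.AtPrime.equivQuotMaximalIdealPow p
      (Y.scheme.presheaf.stalk y.1) n).surjective (Ideal.Quotient.mk _ s)
    obtain ⟨t, rfl⟩ := Ideal.Quotient.mk_surjective t
    rw [IsLocalization.AtPrime.equivQuotMaximalIdealPow_apply_mk, eq_comm,
      Ideal.Quotient.eq] at ht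
    have ht' : t ∈ Submodule.span Γ(X.scheme, U) (Set.range b) := hb ▸ Submodule.mem_top
    obtain ⟨c, rfl⟩ := (Submodule.mem_span_range_iff_exists_fun _).mp ht'
    refine ⟨fun i ↦ X.scheme.presheaf.germ U _ hxU (c i), ?_⟩
    convert ht using 2
    rw [map_sum]
    refine Finset.sum_congr rfl fun i _ ↦ ?_
    rw [Algebra.smul_def, map_mul]
    congr 1
    exact Scheme.Hom.germ_stalkMap_apply f.hom U y.1 hxU (c i)
  · rw [← Curve.toLocalField_algebraMap]
    exact hY _

end Curves

/-! ### Integral birational morphisms onto normal schemes. -/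

section Birational

variable {V W : Scheme.{u}}

theorem isFractionRing_stalk [IsIntegral V] {η : V} (hη : η = genericPoint V) {U : V.Opens}
    (hU : IsAffineOpen U) (hηU : η ∈ U) :
    letI := (V.presheaf.germ U η hηU).hom.toAlgebra
    IsFractionRing Γ(V, U) (V.presheaf.stalk η) := by
  subst hη
  have : Nonempty U := ⟨_, hηU⟩
  exact functionField_isFractionRing_of_isAffineOpen V U hU

theorem genericPoint_mem [IrreducibleSpace V] {U : V.Opens} {x : V} (hx : x ∈ U) :
    genericPoint V ∈ U :=
  (genericPoint_specializes x).mem_open U.2 hx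

/-- An integral birational morphism to a normal scheme is an isomorphism. -/
theorem isIso_of_isIntegralHom [IsIntegral V] [IsIntegral W] (h : V ⟶ W) [IsIntegralHom h]
    (hW : ∀ U : W.Opens, IsAffineOpen U → Nonempty U → IsIntegrallyClosed Γ(W, U))
    (hη : h (genericPoint V) = genericPoint W)
    (hs : Function.Bijective (h.stalkMap (genericPoint V))) : IsIso h := by
  change MorphismProperty.isomorphisms _ h
  refine IsZariskiLocalAtTarget.of_forall_exists_morphismRestrict fun x ↦ ?_
  obtain ⟨_, ⟨U, hU, rfl⟩, hxU, -⟩ :=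
    W.isBasis_affineOpens.exists_subset_of_mem_open (Set.mem_univ x) isOpen_univ
  refine ⟨U, hxU, (isIso_morphismRestrict_iff_isIso_app h hU).mpr ?_⟩
  have hηU : h (genericPoint V) ∈ U := hη ▸ genericPoint_mem hxU
  have := hW U hU ⟨x, hxU⟩
  let := (W.presheaf.germ U (h (genericPoint V)) hηU).hom.toAlgebra
  have hfrac := isFractionRing_stalk hη hU hηU
  have hfrac' : Function.Injective (W.presheaf.germ U (h (genericPoint V)) hηU) :=
    germ_injective_of_isIntegral _ _ hηU
  have hcomm (a : Γ(W, U)) : h.stalkMap (genericPoint V) (W.presheaf.germ U _ hηU a) =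
      V.presheaf.germ (h ⁻¹ᵁ U) (genericPoint V) hηU (h.app U a) :=
    Scheme.Hom.germ_stalkMap_apply h U _ hηU a
  have hinj : Function.Injective (V.presheaf.germ (h ⁻¹ᵁ U) (genericPoint V) hηU) :=
    germ_injective_of_isIntegral (U := h ⁻¹ᵁ U) V (genericPoint V) hηU
  rw [ConcreteCategory.isIso_iff_bijective]
  refine ⟨fun a a' haa ↦ hfrac' (hs.1 ?_), fun b ↦ ?_⟩
  · rw [hcomm, hcomm, haa]
  · obtain ⟨c, hc⟩ := hs.2 (V.presheaf.germ (h ⁻¹ᵁ U) (genericPoint V) hηU b)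
    have hint : _root_.IsIntegral Γ(W, U) c := by
      obtain ⟨P, hP, hPb⟩ := h.isIntegral_app U hU b
      refine ⟨P, hP, hs.1 ?_⟩
      have h1 := congrArg (V.presheaf.germ (h ⁻¹ᵁ U) (genericPoint V) hηU) hPb
      rw [map_zero, Polynomial.hom_eval₂] at h1
      have h2 := Polynomial.hom_eval₂ P (algebraMap Γ(W, U) (W.presheaf.stalk (h (genericPoint V))))
        (h.stalkMap (genericPoint V)).hom c
      refine (h2.trans ?_).trans (map_zero (h.stalkMap (genericPoint V)).hom).symm
      rw [show (h.stalkMap (genericPoint V)).hom c = _ from hc, ← h1]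
      exact congrArg (fun φ ↦ Polynomial.eval₂ φ _ P) (RingHom.ext hcomm)
    obtain ⟨a, ha⟩ := IsIntegrallyClosed.algebraMap_eq_of_integral hint
    refine ⟨a, hinj ?_⟩
    rw [← hcomm, ← hc]
    exact congrArg _ ha

end Birational

/-! ### Smoothness versus separability for finite field extensions. -/

section Separable

variable {K L : Type u} [Field K] [Field L] [Algebra K L]

/-- L is standard smooth, hence étale over a polynomial ring over K. Flatness makes the polynomial
ring inject into L, and L is algebraic over K, so there are no variables and L is étale over K. -/
theorem isSeparable_of_formallySmooth [FiniteDimensional K L] [Algebra.FormallySmooth K L] :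
    Algebra.IsSeparable K L := by
  have : Algebra.FinitePresentation K L := Algebra.FinitePresentation.of_finiteType.mp inferInstance
  have : Algebra.Smooth K L := { }
  obtain ⟨f, hf, hstd⟩ :=
    Algebra.IsSmoothAt.exists_notMem_isStandardSmooth K (⊥ : Ideal L)
  let e : L ≃ₐ[L] Localization.Away f := IsLocalization.atUnit L _ f (isUnit_iff_ne_zero.mpr hf)
  have hL : Algebra.IsStandardSmooth K L := .of_algEquiv (e.restrictScalars K).symm
  obtain ⟨n, g, hg, het⟩ := RingHom.IsStandardSmooth.exists_etale_mvPolynomial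
    (f := algebraMap K L) (RingHom.isStandardSmooth_algebraMap.mpr hL)
  have hflat : g.Flat := (RingHom.Etale.iff_flat_and_formallyUnramified.mp het).1
  have hinj : Function.Injective g := by
    algebraize [g]
    exact FaithfulSMul.algebraMap_injective _ _
  rcases n with _ | n
  · let e₀ := (MvPolynomial.isEmptyRingEquiv K (Fin 0)).symm
    have h0 : ((algebraMap K L) : K →+* L) = g.comp e₀.toRingHom := by
      rw [← hg]
      ext x
      simp [e₀]
    have h1 : (algebraMap K L).Etale := by
      rw [h0]
      exact RingHom.Etale.stableUnderComposition _ _ (.of_bijective e₀.bijective) het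
    have : Algebra.Etale K L := RingHom.etale_algebraMap.mp h1
    exact (Algebra.FormallyEtale.iff_isSeparable K L).mp inferInstance
  · exfalso
    let gA : MvPolynomial (Fin (n + 1)) K →ₐ[K] L := { g with commutes' := fun r ↦ congr($hg r) }
    have := FiniteDimensional.of_injective gA.toLinearMap hinj
    exact MvPolynomial.transcendental_X (R := K) (0 : Fin (n + 1))
      (Algebra.IsAlgebraic.isAlgebraic (R := K) _)

theorem formallySmooth_iff_isSeparable [FiniteDimensional K L] :
    Algebra.FormallySmooth K L ↔ Algebra.IsSeparable K L := by
  refine ⟨fun _ ↦ isSeparable_of_formallySmooth, fun _ ↦ ?_⟩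
  have := Algebra.FormallyEtale.of_isSeparable K L
  infer_instance

/-- The K-algebra generated by B is finite over K. Being an integral domain integral over a field,
it is a field, hence all of L. -/
theorem finiteDimensional_of_isFractionRing {A B : Type u} [CommRing A] [CommRing B]
    [IsDomain B] [Algebra A B] [Module.Finite A B] [Algebra A K] [IsFractionRing A K] [Algebra B L]
    [IsFractionRing B L] [Algebra A L] [IsScalarTower A B L] [IsScalarTower A K L] :
    FiniteDimensional K L := by
  let S : Subalgebra K L := Algebra.adjoin K (Set.range (algebraMap B L))
  have hint : ∀ x ∈ Set.range (algebraMap B L), IsIntegral K x := by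
    rintro _ ⟨b, rfl⟩
    exact ((Algebra.IsIntegral.isIntegral (R := A) b).algebraMap (B := L)).tower_top
  obtain ⟨s, hs⟩ := Module.Finite.fg_top (R := A) (M := B)
  have hS : S = Algebra.adjoin K (algebraMap B L '' s) := by
    refine le_antisymm (Algebra.adjoin_le ?_) (Algebra.adjoin_mono (Set.image_subset_range _ _))
    rintro _ ⟨b, rfl⟩
    have hb : b ∈ Submodule.span A (s : Set B) := hs ▸ Submodule.mem_top
    induction hb using Submodule.span_induction with
    | mem x hx => exact Algebra.subset_adjoin ⟨x, hx, rfl⟩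
    | zero => rw [map_zero]; exact zero_mem _
    | add x y _ _ hx hy => rw [map_add]; exact add_mem hx hy
    | smul a x _ hx =>
      rw [Algebra.smul_def, map_mul, ← IsScalarTower.algebraMap_apply,
        IsScalarTower.algebraMap_apply A K L]
      exact mul_mem (Subalgebra.algebraMap_mem _ _) hx
  have hfin : Module.Finite K S := by
    rw [hS]
    exact Algebra.finite_adjoin_of_finite_of_isIntegral (s.finite_toSet.image _)
      fun x hx ↦ hint x (Set.image_subset_range _ _ hx)
  have hfield : IsField S := isField_of_isIntegral_of_isField'
    (Field.toIsField K)
  have htop : S = ⊤ := by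
    rw [eq_top_iff]
    intro x _
    obtain ⟨a, b, hb, rfl⟩ := IsFractionRing.div_surjective (A := B) x
    have ha : algebraMap B L a ∈ S := Algebra.subset_adjoin ⟨a, rfl⟩
    have hb' : algebraMap B L b ∈ S := Algebra.subset_adjoin ⟨b, rfl⟩
    have hb0 : algebraMap B L b ≠ 0 := IsFractionRing.to_map_ne_zero_of_mem_nonZeroDivisors hb
    obtain ⟨c, hc⟩ := hfield.mul_inv_cancel (a := ⟨_, hb'⟩) (by simpa [Subtype.ext_iff] using hb0)
    have hc' : (algebraMap B L b) * c.1 = 1 := congrArg Subtype.val hc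
    rw [div_eq_mul_inv, inv_eq_of_mul_eq_one_right hc']
    exact mul_mem ha c.2
  rw [htop] at hfin
  exact Module.Finite.equiv Subalgebra.topEquiv.toLinearEquiv

end Separable

/-! ### Function fields of dominant morphisms. -/

section FunctionFields

theorem hom_ext_of_fromSpecStalk {V : Scheme.{u}} {x : V} {A : CommRingCat.{u}} {φ ψ : V.presheaf.stalk x ⟶ A}
    (hφ : Spec.map φ ≫ V.fromSpecStalk x = Spec.map ψ ≫ V.fromSpecStalk x) : φ = ψ :=
  Spec.map_injective ((cancel_mono _).mp hφ)

variable {V W : Scheme.{u}} [IsIntegral V] [IsIntegral W] (h : V ⟶ W)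
  (hη : h (genericPoint V) = genericPoint W)

/-- The map of function fields induced by a dominant morphism of integral schemes. -/
noncomputable def genericStalkMap : W.functionField ⟶ V.functionField :=
  W.presheaf.stalkSpecializes (specializes_of_eq hη) ≫ h.stalkMap (genericPoint V)

theorem formallySmooth_genericStalkMap_iff :
    (genericStalkMap h hη).hom.FormallySmooth ↔
      (h.stalkMap (genericPoint V)).hom.FormallySmooth := by
  have : IsIso (W.presheaf.stalkSpecializes (specializes_of_eq hη)) :=
    (TopCat.Presheaf.stalkCongr W.presheaf (.of_eq hη)).isIso_inv
  rw [genericStalkMap, CommRingCat.hom_comp]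
  exact RingHom.FormallySmooth.respectsIso.cancel_left_isIso
    (W.presheaf.stalkSpecializes (specializes_of_eq hη)) (h.stalkMap (genericPoint V))

theorem bijective_genericStalkMap_iff :
    Function.Bijective (genericStalkMap h hη) ↔
      Function.Bijective (h.stalkMap (genericPoint V)) := by
  have : IsIso (W.presheaf.stalkSpecializes (specializes_of_eq hη)) :=
    (TopCat.Presheaf.stalkCongr W.presheaf (.of_eq hη)).isIso_inv
  rw [← ConcreteCategory.isIso_iff_bijective, ← ConcreteCategory.isIso_iff_bijective,
    genericStalkMap, isIso_comp_left_iff]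

theorem genericStalkMap_germ {U : W.Opens} (hU : h (genericPoint V) ∈ U) (a : Γ(W, U)) :
    genericStalkMap h hη (W.presheaf.germ U (genericPoint W) (hη ▸ hU) a) =
      V.presheaf.germ (h ⁻¹ᵁ U) (genericPoint V) hU (h.app U a) := by
  rw [genericStalkMap, CommRingCat.comp_apply, TopCat.Presheaf.germ_stalkSpecializes_apply]
  exact Scheme.Hom.germ_stalkMap_apply h U _ hU a

theorem SpecMap_genericStalkMap :
    Spec.map (genericStalkMap h hη) ≫ W.fromSpecStalk (genericPoint W) =
      V.fromSpecStalk (genericPoint V) ≫ h := by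
  rw [genericStalkMap, Spec.map_comp, Category.assoc,
    Scheme.SpecMap_stalkSpecializes_fromSpecStalk]
  exact Scheme.SpecMap_stalkMap_fromSpecStalk h

theorem genericStalkMap_comp {T : Scheme.{u}} [IsIntegral T] (a : T ⟶ V)
    (ha : a (genericPoint T) = genericPoint V)
    (hah : (a ≫ h) (genericPoint T) = genericPoint W) :
    genericStalkMap (a ≫ h) hah = genericStalkMap h hη ≫ genericStalkMap a ha := by
  refine hom_ext_of_fromSpecStalk ?_
  rw [SpecMap_genericStalkMap, Spec.map_comp, Category.assoc, SpecMap_genericStalkMap h hη,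
    reassoc_of% SpecMap_genericStalkMap a ha]

theorem finite_genericStalkMap [IsFinite h] : (genericStalkMap h hη).hom.Finite := by
  obtain ⟨_, ⟨U, hU, rfl⟩, hxU, -⟩ := W.isBasis_affineOpens.exists_subset_of_mem_open
    (Set.mem_univ (h (genericPoint V))) isOpen_univ
  have hV : IsAffineOpen (h ⁻¹ᵁ U) := hU.preimage h
  have hfin : (h.app U).hom.Finite := h.finite_app U hU
  let := (h.app U).hom.toAlgebra
  let := (W.presheaf.germ U (genericPoint W) (hη ▸ hxU)).hom.toAlgebra
  let := (V.presheaf.germ (h ⁻¹ᵁ U) (genericPoint V) hxU).hom.toAlgebra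
  let := ((V.presheaf.germ (h ⁻¹ᵁ U) (genericPoint V) hxU).hom.comp (h.app U).hom).toAlgebra
  let := (genericStalkMap h hη).hom.toAlgebra
  have : Module.Finite Γ(W, U) Γ(V, h ⁻¹ᵁ U) := hfin
  have : Nonempty (h ⁻¹ᵁ U : V.Opens) := ⟨⟨_, hxU⟩⟩
  have : IsScalarTower Γ(W, U) Γ(V, h ⁻¹ᵁ U) V.functionField := .of_algebraMap_eq' rfl
  have : IsScalarTower Γ(W, U) W.functionField V.functionField :=
    .of_algebraMap_eq fun a ↦ (genericStalkMap_germ h hη hxU a).symm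
  have := isFractionRing_stalk rfl hU (hη ▸ hxU)
  have := isFractionRing_stalk rfl hV hxU
  exact finiteDimensional_of_isFractionRing (A := Γ(W, U)) (B := Γ(V, h ⁻¹ᵁ U))
    (K := W.functionField) (L := V.functionField)

end FunctionFields

/-! ### Generic smoothness as separability of function fields. -/

section Covers

variable {k : Type u} [Field k] {X Y Z : Curve k}

instance Cover.locallyOfFinitePresentation (f : Cover Y X) : LocallyOfFinitePresentation f.hom :=
  inferInstance

theorem Cover.finite_functionFieldMap (f : Cover Y X) : f.functionFieldMap.Finite :=
  finite_genericStalkMap f.hom f.map_genericPoint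

theorem Cover.finiteDimensional (f : Cover Y X) :
    letI := f.functionFieldAlgebra
    FiniteDimensional X.functionField Y.functionField :=
  f.finite_functionFieldMap

/-- The dense open contains the generic point, where smoothness means that the extension of function
fields is formally smooth. -/
theorem Cover.isSeparable (f : Cover Y X) :
    letI := f.functionFieldAlgebra
    Algebra.IsSeparable X.functionField Y.functionField := by
  let := f.functionFieldAlgebra
  have := f.finiteDimensional
  rw [← formallySmooth_iff_isSeparable]
  obtain ⟨U, hU, hs⟩ := f.genericallySmooth
  obtain ⟨y, hy⟩ := hU.nonempty
  have hη : genericPoint Y.scheme ∈ U := genericPoint_mem hy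
  have h1 : (⟨_, hη⟩ : U) ∈ U.ι ⁻¹ᵁ f.hom.smoothLocus := by
    rw [Scheme.Hom.preimage_smoothLocus_eq, Scheme.Hom.smoothLocus_eq_top]
    trivial
  exact (formallySmooth_genericStalkMap_iff f.hom f.map_genericPoint).mpr h1

/-- The smooth locus is open and contains the generic point, so it serves as the dense open. -/
theorem genericallySmooth_of_isSeparable (h : Y.scheme ⟶ X.scheme)
    [IsFinite h] (hη : h (genericPoint Y.scheme) = genericPoint X.scheme)
    (hs : letI := (genericStalkMap h hη).hom.toAlgebra
      Algebra.IsSeparable X.functionField Y.functionField) :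
    ∃ U : Y.scheme.Opens, Dense (U : Set Y.scheme) ∧ Smooth (U.ι ≫ h) := by
  refine ⟨h.smoothLocus, ?_, ?_⟩
  · refine h.smoothLocus.2.dense ⟨genericPoint Y.scheme, ?_⟩
    let := (genericStalkMap h hη).hom.toAlgebra
    have : FiniteDimensional X.functionField Y.functionField := finite_genericStalkMap h hη
    exact (formallySmooth_genericStalkMap_iff h hη).mp (formallySmooth_iff_isSeparable.mpr hs)
  · rw [← Scheme.Hom.smoothLocus_eq_top_iff, ← Scheme.Hom.preimage_smoothLocus_eq, eq_top_iff]
    rintro x -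
    exact x.2

/-- A finite dominant morphism of curves with separable function field extension is a cover. -/
def Cover.ofIsSeparable (h : Y.scheme ⟶ X.scheme) (w : h ≫ X.str = Y.str)
    [hfin : IsFinite h] (hη : h (genericPoint Y.scheme) = genericPoint X.scheme)
    (hs : letI := (genericStalkMap h hη).hom.toAlgebra
      Algebra.IsSeparable X.functionField Y.functionField) : Cover Y X where
  hom := h
  w := w
  isFinite := hfin
  genericallySmooth := genericallySmooth_of_isSeparable h hη hs

/-- Reduces to transitivity of separability in towers. -/
theorem Cover.genericallySmooth_comp (a : Cover Z Y) (b : Cover Y X) :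
    ∃ U : Z.scheme.Opens, Dense (U : Set Z.scheme) ∧ Smooth (U.ι ≫ a.hom ≫ b.hom) := by
  have hη : (a.hom ≫ b.hom) (genericPoint Z.scheme) = genericPoint X.scheme := by
    rw [Scheme.Hom.comp_apply, a.map_genericPoint, b.map_genericPoint]
  refine genericallySmooth_of_isSeparable (a.hom ≫ b.hom) hη ?_
  rw [genericStalkMap_comp b.hom b.map_genericPoint a.hom a.map_genericPoint]
  let := b.functionFieldAlgebra
  let := a.functionFieldAlgebra
  let := (a.functionFieldMap.comp b.functionFieldMap).toAlgebra
  have : IsScalarTower X.functionField Y.functionField Z.functionField := .of_algebraMap_eq' rfl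
  have := a.isSeparable
  have := b.isSeparable
  exact Algebra.IsSeparable.trans X.functionField Y.functionField Z.functionField

theorem Cover.isIso_of_bijective (f : Cover Y X) (hf : Function.Bijective f.functionFieldMap) :
    IsIso f.hom := by
  refine isIso_of_isIntegralHom f.hom (fun U hU hne ↦ ?_) f.map_genericPoint
    ((bijective_genericStalkMap_iff f.hom f.map_genericPoint).mp hf)
  have := X.isDedekindDomain hU
  infer_instance

theorem Cover.bijective_of_isIso (f : Cover Y X) [IsIso f.hom] :
    Function.Bijective f.functionFieldMap :=
  (bijective_genericStalkMap_iff f.hom f.map_genericPoint).mpr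
    ((ConcreteCategory.isIso_iff_bijective _).mp inferInstance)

end Covers

/-! ### Generic field-valued points of integral schemes. -/

section FieldPoints

variable {V W : Scheme.{u}} [IsIntegral V] [IsIntegral W] {L : Type u} [Field L]

/-- The generic `L`-valued point of an integral scheme given by an embedding of its function field
into `L`. -/
noncomputable def fieldPoint (V : Scheme.{u}) [IsIntegral V] {L : Type u} [Field L]
    (φ : V.functionField →+* L) : Spec (.of L) ⟶ V :=
  Spec.map (CommRingCat.ofHom φ) ≫ V.fromSpecStalk (genericPoint V)

theorem fieldPoint_apply (φ : V.functionField →+* L) (x : Spec (.of L)) :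
    fieldPoint V φ x = genericPoint V := by
  rw [fieldPoint, Scheme.Hom.comp_apply]
  have : Subsingleton (PrimeSpectrum V.functionField) := inferInstance
  rw [show Spec.map (CommRingCat.ofHom φ) x = closedPoint V.functionField from
    Subsingleton.elim (α := PrimeSpectrum V.functionField) _ _]
  exact Scheme.fromSpecStalk_closedPoint

theorem exists_fieldPoint_eq (f : Spec (.of L) ⟶ V) (hf : ∀ x, f x = genericPoint V) :
    ∃ φ : V.functionField →+* L, fieldPoint V φ = f := by
  refine ⟨(V.presheaf.stalkSpecializes (specializes_of_eq (hf (closedPoint L))) ≫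
    Scheme.stalkClosedPointTo f).hom, ?_⟩
  rw [fieldPoint, CommRingCat.ofHom_hom, Spec.map_comp, Category.assoc,
    Scheme.SpecMap_stalkSpecializes_fromSpecStalk, Scheme.Spec_stalkClosedPointTo_fromSpecStalk]

theorem fieldPoint_injective : Function.Injective (fieldPoint V (L := L)) := fun φ ψ h ↦
  congrArg CommRingCat.Hom.hom (hom_ext_of_fromSpecStalk (φ := CommRingCat.ofHom φ)
    (ψ := CommRingCat.ofHom ψ) h)

theorem fieldPoint_comp (h : V ⟶ W) (hη : h (genericPoint V) = genericPoint W)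
    (φ : V.functionField →+* L) :
    fieldPoint V φ ≫ h = fieldPoint W (φ.comp (genericStalkMap h hη).hom) := by
  rw [fieldPoint, fieldPoint, CommRingCat.ofHom_comp, Spec.map_comp, Category.assoc,
    Category.assoc, CommRingCat.ofHom_hom, SpecMap_genericStalkMap]

theorem SpecMap_fieldPoint {M : Type u} [Field M] (φ : V.functionField →+* L) (ψ : L →+* M) :
    Spec.map (CommRingCat.ofHom ψ) ≫ fieldPoint V φ = fieldPoint V (ψ.comp φ) := by
  rw [fieldPoint, fieldPoint, CommRingCat.ofHom_comp, Spec.map_comp, Category.assoc]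

theorem fieldPoint_app (φ : V.functionField →+* L) {U : V.Opens} (hU : genericPoint V ∈ U) :
    (fieldPoint V φ).app U = V.presheaf.germ U _ hU ≫ CommRingCat.ofHom φ ≫
      (Scheme.ΓSpecIso (.of L)).inv ≫ (Spec (.of L)).presheaf.map (homOfLE le_top).op := by
  rw [fieldPoint, Scheme.Hom.comp_app, Scheme.fromSpecStalk_app hU, Category.assoc,
    Category.assoc, Scheme.Hom.naturality]
  exact congrArg (V.presheaf.germ U _ hU ≫ ·)
    (Scheme.ΓSpecIso_inv_naturality_assoc (CommRingCat.ofHom φ) _).symm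

end FieldPoints

/-! ### Normalization of an integral scheme in an extension of its function field. -/

section Normalization

variable {X : Scheme.{u}} [IsIntegral X] {L : Type u} [Field L] (φ : X.functionField →+* L)

instance : QuasiSeparated (fieldPoint X φ) := QuasiSeparated.of_quasiSeparatedSpace _

instance : QuasiCompact (fieldPoint X φ) := by
  rw [fieldPoint]
  infer_instance

theorem toNormalization_apply (x : Spec (.of L)) :
    (fieldPoint X φ).toNormalization x = genericPoint (fieldPoint X φ).normalization := by
  have h : DenseRange (fieldPoint X φ).toNormalization := Scheme.Hom.denseRange _
  have : Unique (Spec (.of L)) := inferInstanceAs (Unique (PrimeSpectrum L))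
  rw [DenseRange, Set.range_eq_singleton_iff (y := (fieldPoint X φ).toNormalization x) |>.mpr
    fun y ↦ by rw [Subsingleton.elim y x]] at h
  exact IsGenericPoint.eq h.closure_eq (genericPoint_spec _)

theorem fromNormalization_genericPoint :
    (fieldPoint X φ).fromNormalization (genericPoint (fieldPoint X φ).normalization) =
      genericPoint X := by
  obtain ⟨x⟩ : Nonempty (Spec (.of L)) := ⟨closedPoint L⟩
  rw [← toNormalization_apply φ x, ← Scheme.Hom.comp_apply,
    Scheme.Hom.toNormalization_fromNormalization, fieldPoint_apply]

theorem exists_fieldPoint_normalization :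
    ∃ ψ : (fieldPoint X φ).normalization.functionField →+* L,
      fieldPoint _ ψ = (fieldPoint X φ).toNormalization :=
  exists_fieldPoint_eq _ (toNormalization_apply φ)

theorem comp_genericStalkMap_fromNormalization
    {ψ : (fieldPoint X φ).normalization.functionField →+* L}
    (hψ : fieldPoint _ ψ = (fieldPoint X φ).toNormalization) :
    ψ.comp (genericStalkMap _ (fromNormalization_genericPoint φ)).hom = φ := by
  apply fieldPoint_injective
  rw [← fieldPoint_comp, hψ, Scheme.Hom.toNormalization_fromNormalization]

theorem restrict_restrict (T : Scheme.{u}) {O₁ O₂ O₃ : (TopologicalSpace.Opens T)ᵒᵖ} (i : O₁ ⟶ O₂)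
    (j : O₂ ⟶ O₃) (l : O₁ ⟶ O₃) (s : T.presheaf.obj O₁) :
    T.presheaf.map j (T.presheaf.map i s) = T.presheaf.map l s := by
  rw [Subsingleton.elim l (i ≫ j), Functor.map_comp, CommRingCat.comp_apply]

theorem restrict_restrict_restrict (T : Scheme.{u}) {O₁ O₂ O₃ : (TopologicalSpace.Opens T)ᵒᵖ}
    (i : O₁ ⟶ O₂) (j : O₂ ⟶ O₃) (l : O₃ ⟶ O₁) (s : T.presheaf.obj O₁) :
    T.presheaf.map l (T.presheaf.map j (T.presheaf.map i s)) = s := by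
  rw [restrict_restrict T j l (j ≫ l), restrict_restrict T i (j ≫ l) (𝟙 _),
    CategoryTheory.Functor.map_id, CommRingCat.id_apply]

/-- The sections of the normalization over an affine open are the elements integral over the
sections of the base. -/
theorem isIntegralClosure_normalization
    {ψ : (fieldPoint X φ).normalization.functionField →+* L}
    (hψ : fieldPoint _ ψ = (fieldPoint X φ).toNormalization) {U : X.Opens} (hU : IsAffineOpen U)
    (hηU : genericPoint (fieldPoint X φ).normalization ∈ (fieldPoint X φ).fromNormalization ⁻¹ᵁ U) :
    letI := (ψ.comp ((fieldPoint X φ).normalization.presheaf.germ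
      ((fieldPoint X φ).fromNormalization ⁻¹ᵁ U) _ hηU).hom).toAlgebra
    letI := ((ψ.comp ((fieldPoint X φ).normalization.presheaf.germ
      ((fieldPoint X φ).fromNormalization ⁻¹ᵁ U) _ hηU).hom).comp
        ((fieldPoint X φ).fromNormalization.app U).hom).toAlgebra
    IsIntegralClosure Γ((fieldPoint X φ).normalization, (fieldPoint X φ).fromNormalization ⁻¹ᵁ U)
      Γ(X, U) L := by
  set f := fieldPoint X φ with hf
  let N := f.normalization
  let V := f.fromNormalization ⁻¹ᵁ U
  let θ : Γ(N, V) →+* L := ψ.comp (N.presheaf.germ V _ hηU).hom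
  have htop : f ⁻¹ᵁ U = ⊤ := by
    rw [eq_top_iff]
    intro x _
    have : genericPoint X ∈ U := by
      rw [← fromNormalization_genericPoint φ]; exact hηU
    rwa [Scheme.Hom.mem_preimage, hf, fieldPoint_apply]
  let κ : Γ(Spec (.of L), f ⁻¹ᵁ U) ≅ .of L :=
    (Spec (.of L)).presheaf.mapIso (eqToIso htop.symm).op ≪≫ Scheme.ΓSpecIso (.of L)
  let := (f.app U).hom.toAlgebra
  have h1 := f.toNormalization_app_preimage ⟨U, hU⟩
  have h2 : f.toNormalization.app (f.fromNormalization ⁻¹ᵁ U) = _ :=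
    (Scheme.Hom.congr_app hψ.symm _).trans (congrArg (· ≫ _) (fieldPoint_app ψ hηU))
  -- Two ways of viewing sections of the normalization inside L agree: by the germ at the generic
  -- point, and by the identification with an integral closure.
  have hθ : CommRingCat.ofHom θ = (f.normalizationObjIso hU).hom ≫
      CommRingCat.ofHom (integralClosure Γ(X, U) Γ(Spec (.of L), f ⁻¹ᵁ U)).val.toRingHom ≫
        κ.hom := by
    have htop' : f.toNormalization ⁻¹ᵁ f.fromNormalization ⁻¹ᵁ U = ⊤ := by
      rw [← Scheme.Hom.comp_preimage, Scheme.Hom.toNormalization_fromNormalization, htop]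
    ext c
    have h3 := congr((Spec (.of L)).presheaf.map (eqToHom htop'.symm).op
      ($(h2.symm.trans h1) c))
    have h4 := (restrict_restrict_restrict (Spec (.of L)) _ _ _ _).symm.trans
      (h3.trans (restrict_restrict (Spec (.of L)) _ _ (eqToHom htop.symm).op _))
    have h5 := congr((Scheme.ΓSpecIso (.of L)).hom $h4)
    refine Eq.trans ?_ h5
    exact congr($((Scheme.ΓSpecIso (.of L)).inv_hom_id).hom (θ c)).symm
  have hθκ (c) : θ c = κ.hom ((f.normalizationObjIso hU).hom c).1 := congr($hθ c)
  have hκ : Function.Bijective κ.hom := (ConcreteCategory.isIso_iff_bijective _).mp inferInstance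
  have hobj : Function.Bijective (f.normalizationObjIso hU).hom :=
    (ConcreteCategory.isIso_iff_bijective _).mp inferInstance
  have hcomm (a : Γ(X, U)) : θ (f.fromNormalization.app U a) = κ.hom (f.app U a) := by
    rw [hθκ, f.fromNormalization_app hU]
    simp
    rfl
  refine @IsIntegralClosure.mk _ _ _ _ _ _ (_) (_) ?_ fun {x} ↦ ?_
  · refine fun c c' h ↦ hobj.1 (Subtype.ext (hκ.1 ?_))
    rw [← hθκ, ← hθκ]
    exact h
  · obtain ⟨y, rfl⟩ := hκ.2 x
    trans _root_.IsIntegral Γ(X, U) y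
    · refine exists_congr fun P ↦ and_congr_right fun _ ↦ ?_
      rw [← hκ.1.eq_iff, map_zero, ]
      have := Polynomial.hom_eval₂ P (f.app U).hom κ.hom.hom y
      refine Eq.congr_left (Eq.trans ?_ this.symm)
      exact congrArg (fun φ ↦ Polynomial.eval₂ φ _ P) (RingHom.ext hcomm)
    · constructor
      · intro hy
        obtain ⟨c, hc⟩ := hobj.2 ⟨y, hy⟩
        exact ⟨c, (hθκ c).trans (by rw [hc])⟩
      · rintro ⟨c, hc⟩
        have := hκ.1 ((hθκ c).symm.trans hc)
        rw [← this]
        exact ((f.normalizationObjIso hU).hom c).2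

end Normalization

/-! ### Every finite separable extension is the function field of a curve. -/

section NormalizationCurve

variable {k : Type u} [Field k] {X : Curve k} {L : Type u} [Field L]
  (φ : X.functionField →+* L)

/-- The sections are the integral closure of a Dedekind domain in a finite separable extension L. It
is therefore finite and Dedekind, with fraction field L. -/
theorem finite_and_isDedekindDomain_normalization
    {ψ : (fieldPoint X.scheme φ).normalization.functionField →+* L}
    (hψ : fieldPoint _ ψ = (fieldPoint X.scheme φ).toNormalization)
    (hfin : φ.Finite) (hsep : letI := φ.toAlgebra; Algebra.IsSeparable X.functionField L)
    {U : X.scheme.Opens} (hU : IsAffineOpen U) (hne : Nonempty U) :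
    ((fieldPoint X.scheme φ).fromNormalization.app U).hom.Finite ∧
      IsDedekindDomain Γ((fieldPoint X.scheme φ).normalization,
        (fieldPoint X.scheme φ).fromNormalization ⁻¹ᵁ U) ∧ Function.Surjective ψ := by
  have := X.isDedekindDomain hU
  obtain ⟨⟨x, hx⟩⟩ := hne
  have hηU := genericPoint_mem hx
  have hηV : genericPoint (fieldPoint X.scheme φ).normalization ∈
      (fieldPoint X.scheme φ).fromNormalization ⁻¹ᵁ U := by
    rwa [Scheme.Hom.mem_preimage, fromNormalization_genericPoint]
  have hcl := isIntegralClosure_normalization φ hψ hU hηV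
  set N := (fieldPoint X.scheme φ).normalization
  set π := (fieldPoint X.scheme φ).fromNormalization
  let := φ.toAlgebra
  let := (X.scheme.presheaf.germ U _ hηU).hom.toAlgebra
  let := (ψ.comp (N.presheaf.germ (π ⁻¹ᵁ U) _ hηV).hom).toAlgebra
  let := ((ψ.comp (N.presheaf.germ (π ⁻¹ᵁ U) _ hηV).hom).comp (π.app U).hom).toAlgebra
  let := (π.app U).hom.toAlgebra
  have : FiniteDimensional X.functionField L := hfin
  have : IsScalarTower Γ(X.scheme, U) Γ(N, π ⁻¹ᵁ U) L := .of_algebraMap_eq' rfl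
  have : IsScalarTower Γ(X.scheme, U) X.functionField L := by
    refine .of_algebraMap_eq fun a ↦ ?_
    have h1 := comp_genericStalkMap_fromNormalization φ hψ
    have h2 := genericStalkMap_germ π (fromNormalization_genericPoint φ) hηV a
    exact (congrArg ψ h2.symm).trans congr($h1 _)
  have := isFractionRing_stalk rfl hU hηU
  have : Nonempty (π ⁻¹ᵁ U : N.Opens) := ⟨⟨_, hηV⟩⟩
  have := IsIntegralClosure.finite Γ(X.scheme, U) X.functionField L Γ(N, π ⁻¹ᵁ U)
  have := IsIntegralClosure.isDedekindDomain Γ(X.scheme, U) X.functionField L Γ(N, π ⁻¹ᵁ U)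
  refine ⟨‹Module.Finite Γ(X.scheme, U) Γ(N, π ⁻¹ᵁ U)›, this, fun x ↦ ?_⟩
  have := IsIntegralClosure.isFractionRing_of_finite_extension Γ(X.scheme, U) X.functionField L
    Γ(N, π ⁻¹ᵁ U)
  obtain ⟨a, b, -, rfl⟩ := IsFractionRing.div_surjective (A := Γ(N, π ⁻¹ᵁ U)) x
  exact ⟨N.presheaf.germ (π ⁻¹ᵁ U) _ hηV a / N.presheaf.germ (π ⁻¹ᵁ U) _ hηV b, map_div₀ ψ _ _⟩

theorem isFinite_fromNormalization
    (hfin : φ.Finite) (hsep : letI := φ.toAlgebra; Algebra.IsSeparable X.functionField L) :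
    IsFinite (fieldPoint X.scheme φ).fromNormalization := by
  refine { finite_app := fun U hU ↦ ?_ }
  obtain ⟨ψ, hψ⟩ := exists_fieldPoint_normalization φ
  rcases isEmpty_or_nonempty U with h | h
  · have hU' : U = ⊥ := by
      ext x
      simpa using fun hx ↦ h.elim ⟨x, hx⟩
    subst hU'
    have : Subsingleton Γ((fieldPoint X.scheme φ).normalization,
      (fieldPoint X.scheme φ).fromNormalization ⁻¹ᵁ ⊥) :=
      inferInstanceAs (Subsingleton Γ((fieldPoint X.scheme φ).normalization, ⊥))
    exact RingHom.Finite.of_surjective _ fun x ↦ ⟨0, Subsingleton.elim _ _⟩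
  · exact (finite_and_isDedekindDomain_normalization φ hψ hfin hsep hU h).1

theorem isSmoothProjectiveCurve_normalization
    (hfin : φ.Finite) (hsep : letI := φ.toAlgebra; Algebra.IsSeparable X.functionField L) :
    IsSmoothProjectiveCurve ((fieldPoint X.scheme φ).fromNormalization ≫ X.str) where
  isIntegral := inferInstance
  isProper := by
    have := isFinite_fromNormalization φ hfin hsep
    infer_instance
  isDiscreteValuationRing x hx := by
    let N := (fieldPoint X.scheme φ).normalization
    let π : N ⟶ X.scheme := (fieldPoint X.scheme φ).fromNormalization
    obtain ⟨ψ, hψ⟩ := exists_fieldPoint_normalization φ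
    obtain ⟨_, ⟨U, hU, rfl⟩, hxU, -⟩ :=
      X.scheme.isBasis_affineOpens.exists_subset_of_mem_open (Set.mem_univ (π x)) isOpen_univ
    have hV : IsAffineOpen (π ⁻¹ᵁ U) := hU.preimage π
    have hD := (finite_and_isDedekindDomain_normalization φ hψ hfin hsep hU ⟨_, hxU⟩).2.1
    have hmax := hV.primeIdealOf_isMaximal_of_isClosed ⟨x, hxU⟩ hx
    let := TopCat.Presheaf.algebra_section_stalk N.presheaf (⟨x, hxU⟩ : (π ⁻¹ᵁ U : N.Opens))
    have hloc := hV.isLocalization_stalk ⟨x, hxU⟩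
    refine IsLocalization.AtPrime.isDiscreteValuationRing_of_dedekind_domain _
      (P := (hV.primeIdealOf ⟨x, hxU⟩).asIdeal) (fun h0 ↦ ?_) _
    -- The prime of a closed point is nonzero: otherwise the sections upstairs form a field, so by
    -- integrality those over U do too. The stalk at π(x) would then be a field instead of a
    -- discrete valuation ring.
    have hfield : IsField Γ(N, π ⁻¹ᵁ U) := by
      rw [h0] at hmax
      exact Ring.isField_iff_maximal_bot.mpr hmax
    have hclosed : IsClosed {π x} := by
      have := π.isClosedMap _ hx
      rwa [Set.image_singleton] at this
    have := X.isCurve.isDiscreteValuationRing _ hclosed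
    have hη : genericPoint N ∈ π ⁻¹ᵁ U := genericPoint_mem hxU
    have hinj : Function.Injective (π.app U) := by
      intro a b hab
      have h1 := genericStalkMap_germ π (fromNormalization_genericPoint φ) hη
      have : Nonempty U := ⟨_, hxU⟩
      refine germ_injective_of_isIntegral X.scheme _ (genericPoint_mem hxU)
        ((genericStalkMap π (fromNormalization_genericPoint φ)).hom.injective ?_)
      exact (h1 a).trans ((congrArg _ hab).trans (h1 b).symm)
    have hfieldU : IsField Γ(X.scheme, U) := by
      let := (π.app U).hom.toAlgebra
      have : Algebra.IsIntegral Γ(X.scheme, U) Γ(N, π ⁻¹ᵁ U) := ⟨π.isIntegral_app U hU⟩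
      exact isField_of_isIntegral_of_isField hinj hfield
    let := TopCat.Presheaf.algebra_section_stalk X.scheme.presheaf (⟨π x, hxU⟩ : U)
    have := hU.isLocalization_stalk ⟨π x, hxU⟩
    have hbij := IsField.localization_map_bijective
      (M := (hU.primeIdealOf ⟨π x, hxU⟩).asIdeal.primeCompl)
      (Rₘ := X.scheme.presheaf.stalk (π x)) (by simp) hfieldU
    exact IsDiscreteValuationRing.not_isField (X.scheme.presheaf.stalk (π x))
      ((MulEquiv.isField hfieldU (RingEquiv.ofBijective _ hbij).symm.toMulEquiv))

/-- The normalization of a curve in a finite separable extension of its function field. -/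
noncomputable def normalizationCurve
    (hfin : φ.Finite) (hsep : letI := φ.toAlgebra; Algebra.IsSeparable X.functionField L) :
    Curve k :=
  ⟨_, _, isSmoothProjectiveCurve_normalization φ hfin hsep⟩

theorem exists_cover_normalization
    (hfin : φ.Finite) (hsep : letI := φ.toAlgebra; Algebra.IsSeparable X.functionField L) :
    ∃ (b : Cover (normalizationCurve φ hfin hsep) X)
      (e : (normalizationCurve φ hfin hsep).functionField ≃+* L),
      b.hom = (fieldPoint X.scheme φ).fromNormalization ∧
      fieldPoint _ e.toRingHom = (fieldPoint X.scheme φ).toNormalization ∧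
      e.toRingHom.comp b.functionFieldMap = φ := by
  obtain ⟨ψ, hψ⟩ := exists_fieldPoint_normalization φ
  have := isFinite_fromNormalization φ hfin hsep
  have hη := fromNormalization_genericPoint φ
  have hcomp := comp_genericStalkMap_fromNormalization φ hψ
  have hsurj : Function.Surjective ψ := by
    obtain ⟨_, ⟨U, hU, rfl⟩, hxU, -⟩ := X.scheme.isBasis_affineOpens.exists_subset_of_mem_open
      (Set.mem_univ (genericPoint X.scheme)) isOpen_univ
    exact (finite_and_isDedekindDomain_normalization φ hψ hfin hsep hU ⟨_, hxU⟩).2.2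
  let b : Cover (normalizationCurve φ hfin hsep) X := @Cover.ofIsSeparable _ _ _ _
      (fieldPoint X.scheme φ).fromNormalization rfl this hη <| by
    let := φ.toAlgebra
    let := (genericStalkMap _ hη).hom.toAlgebra
    let := ψ.toAlgebra
    have : IsScalarTower X.functionField (fieldPoint X.scheme φ).normalization.functionField L :=
      .of_algebraMap_eq' hcomp.symm
    exact Algebra.isSeparable_tower_bot_of_isSeparable X.functionField
      (fieldPoint X.scheme φ).normalization.functionField L
  exact ⟨b, RingEquiv.ofBijective ψ ⟨ψ.injective, hsurj⟩, rfl, hψ, hcomp⟩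

end NormalizationCurve

/-! ### Embeddings of function fields as covers; flatness of covers. -/

section Morphisms

variable {k : Type u} [Field k] {X C D : Curve k}

/-- Covers of `X` are determined by their function fields: embeddings of function fields over
`k(X)` come from covers. -/
theorem Cover.exists_cover_functionFieldMap_eq (a : Cover C X) (b : Cover D X)
    (φ : D.functionField →+* C.functionField)
    (hφ : φ.comp b.functionFieldMap = a.functionFieldMap) :
    ∃ h : Cover C D, h.hom ≫ b.hom = a.hom ∧ h.functionFieldMap = φ := by
  -- The normalization of X in k(C) maps to both C and D by its universal property. The map to C is
  -- integral and birational onto a normal scheme, so it can be inverted.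
  let f := fieldPoint X.scheme a.functionFieldMap
  have hC : f = fieldPoint C.scheme (RingHom.id _) ≫ a.hom := by
    rw [fieldPoint_comp _ a.map_genericPoint]
    rfl
  have hD : f = fieldPoint D.scheme φ ≫ b.hom := by
    rw [fieldPoint_comp _ b.map_genericPoint]
    exact congrArg (fieldPoint X.scheme) hφ.symm
  obtain ⟨ψ, hψ⟩ := exists_fieldPoint_normalization a.functionFieldMap
  let d := f.normalizationDesc _ _ hC
  have hd : f.toNormalization ≫ d = _ := f.toNormalization_normalizationDesc _ _ hC
  have hda : d ≫ a.hom = f.fromNormalization := f.normalizationDesc_comp _ _ hC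
  have hdη : d (genericPoint f.normalization) = genericPoint C.scheme := by
    obtain ⟨x⟩ : Nonempty (Spec (.of C.functionField)) := ⟨closedPoint C.functionField⟩
    rw [← toNormalization_apply a.functionFieldMap x, ← Scheme.Hom.comp_apply, hd, fieldPoint_apply]
  have hψd : ψ.comp (genericStalkMap d hdη).hom = RingHom.id _ := by
    apply fieldPoint_injective
    rw [← fieldPoint_comp, hψ, hd]
  have : IsIso d := by
    refine isIso_of_isIntegralHom d (fun U hU _ ↦ ?_) hdη
      ((bijective_genericStalkMap_iff d hdη).mp ⟨(genericStalkMap d hdη).hom.injective,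
        fun x ↦ ⟨ψ x, ψ.injective congr($hψd (ψ x))⟩⟩)
    have := C.isDedekindDomain hU
    infer_instance
  let h := inv d ≫ f.normalizationDesc _ _ hD
  have hb : h ≫ b.hom = a.hom := by
    rw [Category.assoc, f.normalizationDesc_comp _ _ hD, ← hda, IsIso.inv_hom_id_assoc]
  have hpt : fieldPoint C.scheme (RingHom.id _) ≫ h = fieldPoint D.scheme φ := by
    rw [← hd, Category.assoc, IsIso.hom_inv_id_assoc, f.toNormalization_normalizationDesc _ _ hD]
  have hη : h (genericPoint C.scheme) = genericPoint D.scheme := by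
    obtain ⟨x⟩ : Nonempty (Spec (.of C.functionField)) := ⟨closedPoint C.functionField⟩
    rw [← fieldPoint_apply (RingHom.id C.functionField) x, ← Scheme.Hom.comp_apply, hpt,
      fieldPoint_apply]
  have hmap : (genericStalkMap h hη).hom = φ := by
    apply fieldPoint_injective
    rw [← hpt, fieldPoint_comp _ hη]
    rfl
  have : IsFinite (h ≫ b.hom) := hb ▸ inferInstance
  have : IsFinite h := IsFinite.of_comp h b.hom
  have hs : letI := (genericStalkMap h hη).hom.toAlgebra
      Algebra.IsSeparable D.functionField C.functionField := by
    let := (genericStalkMap h hη).hom.toAlgebra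
    let := a.functionFieldAlgebra
    let := b.functionFieldAlgebra
    have : IsScalarTower X.functionField D.functionField C.functionField := by
      refine .of_algebraMap_eq' (hφ.symm.trans ?_)
      rw [← hmap]
      rfl
    have := a.isSeparable
    exact Algebra.isSeparable_tower_top_of_isSeparable X.functionField _ _
  refine ⟨Cover.ofIsSeparable h ?_ hη hs, hb, hmap⟩
  rw [← b.w, ← Category.assoc, hb, a.w]

/-- Over a Dedekind domain torsion-free modules are flat, and sections on C are torsion-free because
function fields embed. -/
instance Cover.flat (f : Cover C X) : Flat f.hom := by
  rw [HasRingHomProperty.iff_appLE (P := @Flat)]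
  rintro ⟨U, hU⟩ ⟨V, hV⟩ e
  algebraize [(f.hom.appLE U V e).hom]
  change Module.Flat Γ(X.scheme, U) Γ(C.scheme, V)
  rcases isEmpty_or_nonempty V with h | h
  · have hV' : V = ⊥ := by
      ext x
      simpa using fun hx ↦ h.elim ⟨x, hx⟩
    subst hV'
    have : Subsingleton Γ(C.scheme, ⊥) := inferInstance
    infer_instance
  · obtain ⟨x, hx⟩ := h
    have hU' : Nonempty U := ⟨⟨_, e hx⟩⟩
    have hD := X.isDedekindDomain hU
    rw [Module.Flat.flat_iff_torsion_eq_bot_of_valuationRing_localization_isMaximal,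
      ← Submodule.isTorsionFree_iff_torsion_eq_bot]
    · have : Nonempty V := ⟨⟨x, hx⟩⟩
      rw [Module.isTorsionFree_iff_algebraMap_injective]
      intro s t hst
      have hη : genericPoint X.scheme ∈ U := genericPoint_mem (e hx)
      have hηV := genericPoint_mem hx
      refine germ_injective_of_isIntegral X.scheme _ hη (f.functionFieldMap.injective ?_)
      have h1 (s) : f.functionFieldMap (X.scheme.presheaf.germ U _ hη s) =
          C.scheme.presheaf.germ V _ hηV (f.hom.appLE U V e s) := by
        refine (genericStalkMap_germ f.hom f.map_genericPoint (e hηV) s).trans ?_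
        rw [Scheme.Hom.appLE, CommRingCat.comp_apply, TopCat.Presheaf.germ_res_apply]
      rw [h1, h1]
      exact congrArg _ hst
    · intro P hP
      -- The zero ideal is maximal only if the ring is a field. That case is separate because the
      -- localization is then not a discrete valuation ring.
      rcases eq_or_ne P ⊥ with rfl | hP0
      · have hF := Ring.isField_iff_maximal_bot.mpr hP
        have hbij := IsField.localization_map_bijective (M := (⊥ : Ideal Γ(X.scheme, U)).primeCompl)
          (Rₘ := Localization (⊥ : Ideal Γ(X.scheme, U)).primeCompl) (by simp) hF
        have hF' := MulEquiv.isField hF (RingEquiv.ofBijective _ hbij).symm.toMulEquiv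
        let := hF'.toField
        exact ValuationRing.of_field (Localization (⊥ : Ideal Γ(X.scheme, U)).primeCompl)
      · have := IsLocalization.AtPrime.isDiscreteValuationRing_of_dedekind_domain
          Γ(X.scheme, U) hP0 (Localization P.primeCompl)
        infer_instance

end Morphisms

/-! ### Normalization and integral morphisms of the base. -/

section Comparison

/-- As `h` is integral, the normalization of S in T is integral over Y as well, so the two universal
properties give mutually inverse maps. This turns the normalization of the fiber product into a
normalization of Y. -/
theorem exists_iso_normalization {T T' S Y : Scheme.{u}} (g : T ⟶ S) [QuasiCompact g]
    [QuasiSeparated g] (h : S ⟶ Y) [IsIntegralHom h] (g' : T' ⟶ Y) [QuasiCompact g']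
    [QuasiSeparated g'] (i : T' ≅ T) (hi : g' = i.hom ≫ g ≫ h) :
    ∃ e : g'.normalization ≅ g.normalization,
      e.hom ≫ g.fromNormalization ≫ h = g'.fromNormalization ∧
        g'.toNormalization ≫ e.hom = i.hom ≫ g.toNormalization := by
  have h₁ : g' = (i.hom ≫ g.toNormalization) ≫ g.fromNormalization ≫ h := by simp [hi]
  have h₂ : g' = (i.hom ≫ g) ≫ h := by simp [hi]
  let d := g'.normalizationDesc _ _ h₂
  have h₃ : g = (i.inv ≫ g'.toNormalization) ≫ d := by simp [d]
  let e := g'.normalizationDesc _ _ h₁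
  let e' := g.normalizationDesc _ _ h₃
  have hd : e ≫ g.fromNormalization = d :=
    Scheme.Hom.normalization.hom_ext g' _ _ h (by simp [e, d]) (by simp [e]) (by simp [d])
  refine ⟨⟨e, e', ?_, ?_⟩, by simp [e], by simp [e]⟩
  · refine Scheme.Hom.normalization.hom_ext g' _ _ g'.fromNormalization (by simp [e, e']) ?_
      (by simp)
    have hdh : d ≫ h = g'.fromNormalization := by simp [d]
    have he' : e' ≫ d = g.fromNormalization := by simp [e']
    rw [← hdh, Category.assoc, reassoc_of% he', hdh]
    simp [e]
  · refine Scheme.Hom.normalization.hom_ext g _ _ g.fromNormalization (by simp [e, e']) ?_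
      (by simp)
    rw [Category.assoc, hd]
    simp [e']

end Comparison

/-! ### The generic point of the fiber product of two covers. -/

section FiberProduct

variable {k : Type u} [Field k] {W Y X : Curve k} (p : Cover W X) (f : Cover Y X)

/-- Flat morphisms lift generalizations, and a generic point of a component has no proper
generalization. -/
theorem map_mem_genericPoint_of_flat {S V : Scheme.{u}} [IsIntegral V] (h : S ⟶ V) [Flat h]
    {s : S} (hs : s ∈ genericPoints S) : h s = genericPoint V := by
  obtain ⟨s', hs', h'⟩ := Flat.generalizingMap h (genericPoint_specializes (h s))
  have h1 : closure {s} = closure {s'} := Maximal.eq_of_le hs isIrreducible_singleton.closure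
    (specializes_iff_closure_subset.mp hs')
  rw [(inseparable_iff_closure_eq.mpr h1).eq, h']

theorem exists_iso_coproduct_residueField {S : Scheme.{u}} {s : S} (hs : s ∈ genericPoints S)
    (huniq : ∀ s' ∈ genericPoints S, s' = s) :
    ∃ i : Spec (S.residueField s) ≅ ∐ fun η : genericPoints S ↦ Spec (S.residueField η.1),
      i.hom ≫ genericPointsHom S = S.fromSpecResidueField s := by
  let : Unique (genericPoints S) := ⟨⟨⟨s, hs⟩⟩, fun s ↦ Subtype.ext (huniq _ s.2)⟩
  let c : genericPoints S → Scheme.{u} := fun η ↦ Spec (S.residueField η.1)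
  refine ⟨(coproductUniqueIso c).symm, ?_⟩
  rw [Iso.symm_hom, coproductUniqueIso_inv]
  exact Sigma.ι_desc _ (default : genericPoints S)

variable {F : Type u} [Field F] (α : W.functionField →+* F) (β : Y.functionField →+* F)
  (hαβ : α.comp p.functionFieldMap = β.comp f.functionFieldMap)

theorem fieldPoint_comp_hom_eq {E : Type u} [Field E] (α : W.functionField →+* E)
    (β : Y.functionField →+* E)
    (hαβ : α.comp p.functionFieldMap = β.comp f.functionFieldMap) :
    fieldPoint W.scheme α ≫ p.hom = fieldPoint Y.scheme β ≫ f.hom := by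
  rw [fieldPoint_comp _ p.map_genericPoint, fieldPoint_comp _ f.map_genericPoint]
  exact congrArg (fieldPoint X.scheme) hαβ

theorem exists_fieldPoint_lift {E : Type u} [Field E] (t : Spec (.of E) ⟶ pullback p.hom f.hom)
    (ht : ∀ x, t x ∈ genericPoints (pullback p.hom f.hom : Scheme.{u})) :
    ∃ (α : W.functionField →+* E) (β : Y.functionField →+* E),
      α.comp p.functionFieldMap = β.comp f.functionFieldMap ∧
      fieldPoint W.scheme α = t ≫ pullback.fst _ _ ∧
      fieldPoint Y.scheme β = t ≫ pullback.snd _ _ := by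
  obtain ⟨α, hα⟩ := exists_fieldPoint_eq (t ≫ pullback.fst p.hom f.hom) fun x ↦ by
    rw [Scheme.Hom.comp_apply, map_mem_genericPoint_of_flat _ (ht x)]
  obtain ⟨β, hβ⟩ := exists_fieldPoint_eq (t ≫ pullback.snd p.hom f.hom) fun x ↦ by
    rw [Scheme.Hom.comp_apply, map_mem_genericPoint_of_flat _ (ht x)]
  refine ⟨α, β, fieldPoint_injective ?_, hα, hβ⟩
  have h1 := fieldPoint_comp p.hom p.map_genericPoint α
  have h2 := fieldPoint_comp f.hom f.map_genericPoint β
  refine h1.symm.trans (Eq.trans ?_ h2)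
  rw [hα, hβ, Category.assoc, Category.assoc, pullback.condition]

/-- By flatness each generic point s gives compatible embeddings of k(W) and k(Y) in its residue
field, hence a map there from F. So s is the image of Spec F, which proves uniqueness. Conversely
the residue field maps to F, and the composite through F is the identity, so the two fields agree.
-/
theorem exists_iso_genericPoints
    (hF : ∀ (E : Type u) [Field E] (α' : W.functionField →+* E) (β' : Y.functionField →+* E),
      α'.comp p.functionFieldMap = β'.comp f.functionFieldMap →
      ∃ γ : F →+* E, γ.comp α = α' ∧ γ.comp β = β') :
    ∃ i : Spec (.of F) ≅ ∐ fun η : genericPoints (pullback p.hom f.hom : Scheme.{u}) ↦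
        Spec ((pullback p.hom f.hom : Scheme.{u}).residueField η.1),
      i.hom ≫ genericPointsHom _ =
        pullback.lift _ _ (fieldPoint_comp_hom_eq p f α β hαβ) := by
  set S := (pullback p.hom f.hom : Scheme.{u}) with hS
  set t : Spec (.of F) ⟶ S := pullback.lift _ _ (fieldPoint_comp_hom_eq p f α β hαβ)
  have key (s : S) (hs : s ∈ genericPoints S) : ∃ γ : F →+* S.residueField s,
      Spec.map (CommRingCat.ofHom γ) ≫ t = S.fromSpecResidueField s := by
    obtain ⟨α', β', h, hα, hβ⟩ := exists_fieldPoint_lift p f (E := S.residueField s)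
      (S.fromSpecResidueField s) fun x ↦
        (Scheme.fromSpecResidueField_apply s x).symm ▸ hs
    obtain ⟨γ, rfl, rfl⟩ := hF _ α' β' h
    refine ⟨γ, pullback.hom_ext ?_ ?_⟩
    · rw [Category.assoc, pullback.lift_fst, SpecMap_fieldPoint]
      exact hα
    · rw [Category.assoc, pullback.lift_snd, SpecMap_fieldPoint]
      exact hβ
  obtain ⟨x⟩ : Nonempty (Spec (.of F)) := ⟨closedPoint F⟩
  have hx (y : Spec (.of F)) : y = x := Subsingleton.elim (α := PrimeSpectrum F) _ _
  have huniq (s : S) (hs : s ∈ genericPoints S) : s = t x := by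
    obtain ⟨γ, hγ⟩ := key s hs
    obtain ⟨z⟩ : Nonempty (Spec (S.residueField s)) := inferInstance
    rw [← Scheme.fromSpecResidueField_apply s z, ← hγ, Scheme.Hom.comp_apply]
    exact congrArg t (hx _)
  have hmem : t x ∈ genericPoints S := by
    obtain ⟨s, hs⟩ : (genericPoints S).Nonempty := by
      by_contra h
      have := genericPoints.closure (α := S)
      rw [Set.not_nonempty_iff_eq_empty.mp h, closure_empty] at this
      exact Set.notMem_empty (t x) (this ▸ Set.mem_univ _)
    exact huniq s hs ▸ hs
  obtain ⟨γ, hγ⟩ := key (t x) hmem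
  have hpt : closedPoint F = x := hx _
  obtain ⟨δ, hδ⟩ : ∃ δ : S.residueField (t x) ⟶ .of F,
      Spec.map δ ≫ S.fromSpecResidueField (t x) = t := by
    rw [← hpt]
    exact ⟨_, Scheme.descResidueField_stalkClosedPointTo_fromSpecResidueField F S t⟩
  have hδγ : δ ≫ CommRingCat.ofHom γ = 𝟙 _ := by
    apply Spec.map_injective
    rw [← cancel_mono (S.fromSpecResidueField (t x)), Spec.map_comp, Category.assoc, hδ, hγ,
      Spec.map_id]
    exact (Category.id_comp _).symm
  have hγi : IsIso (CommRingCat.ofHom γ) := by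
    rw [ConcreteCategory.isIso_iff_bijective]
    exact ⟨γ.injective, fun y ↦ ⟨δ y, congr($hδγ y)⟩⟩
  have hδγ' : IsIso (δ ≫ CommRingCat.ofHom γ) := hδγ ▸ inferInstance
  have hδi : IsIso δ := IsIso.of_isIso_comp_right δ (CommRingCat.ofHom γ)
  obtain ⟨j, hj⟩ := exists_iso_coproduct_residueField hmem huniq
  exact ⟨asIso (Spec.map δ) ≪≫ j, by rw [Iso.trans_hom, Category.assoc, hj, asIso_hom, hδ]⟩

end FiberProduct

/-! ### The normalized fiber product as a curve with two covers. -/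

section

variable {k : Type u} [Field k]

theorem IsSmoothProjectiveCurve.of_iso {A B : Scheme.{u}} {s : A ⟶ Spec (.of k)}
    (hs : IsSmoothProjectiveCurve s) {s' : B ⟶ Spec (.of k)} (e : A ≅ B) (h : e.hom ≫ s' = s) :
    IsSmoothProjectiveCurve s' where
  isIntegral := by
    have := hs.isIntegral
    have : Nonempty B := ⟨e.hom (genericPoint A)⟩
    exact isIntegral_of_isOpenImmersion e.inv
  isProper := by
    have := hs.isProper
    rw [show s' = e.inv ≫ s by rw [← h, e.inv_hom_id_assoc]]
    infer_instance
  isDiscreteValuationRing x hx := by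
    have hx' : IsClosed {e.inv x} := by
      have := (Scheme.homeoOfIso e).symm.isClosedMap _ hx
      rwa [Set.image_singleton] at this
    have := hs.isIntegral
    have : Nonempty B := ⟨e.hom (genericPoint A)⟩
    have := isIntegral_of_isOpenImmersion e.inv
    have := hs.isDiscreteValuationRing _ hx'
    exact IsDiscreteValuationRing.RingEquivClass.isDiscreteValuationRing
      (asIso (e.inv.stalkMap x)).commRingCatIsoToRingEquiv

variable {X Y : Curve k}

theorem isSeparable_of_comp_genericStalkMap {L : Type u} [Field L] {V W : Scheme.{u}}
    [IsIntegral V] [IsIntegral W] (h : V ⟶ W) (hη : h (genericPoint V) = genericPoint W)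
    (φ : W.functionField →+* L) (ψ : V.functionField →+* L)
    (hψ : ψ.comp (genericStalkMap h hη).hom = φ)
    (hs : letI := φ.toAlgebra; Algebra.IsSeparable W.functionField L) :
    letI := (genericStalkMap h hη).hom.toAlgebra
    Algebra.IsSeparable W.functionField V.functionField := by
  let := φ.toAlgebra
  let := (genericStalkMap h hη).hom.toAlgebra
  let := ψ.toAlgebra
  have : IsScalarTower W.functionField V.functionField L := .of_algebraMap_eq' hψ.symm
  exact Algebra.isSeparable_tower_bot_of_isSeparable W.functionField V.functionField L

/-- The function field of `Z` is identified with `F` so that `g` and `q` correspond to the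
embeddings `α` and `β`. -/
def IsModelOf {Z W Y : Curve k} (g : Cover Z W) (q : Cover Z Y) {F : Type u} [Field F]
    (α : W.functionField →+* F) (β : Y.functionField →+* F) : Prop :=
  ∃ e : F ≃+* Z.functionField,
    (∀ a, e (α a) = g.functionFieldMap a) ∧ ∀ b, e (β b) = q.functionFieldMap b

variable {W Y X : Curve k} (p : Cover W X) (f : Cover Y X)
    {F : Type u} [Field F] (α : W.functionField →+* F) (β : Y.functionField →+* F)

/-- Evaluating both projections on the F-valued generic point of Z identifies k(Z) with F and the
two maps of function fields with `α` and `β`. -/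
theorem exists_covers_of_iso_normalization
    (hαβ : α.comp p.functionFieldMap = β.comp f.functionFieldMap)
    (hfin : β.Finite) (hsep : letI := β.toAlgebra; Algebra.IsSeparable Y.functionField F)
    {Z : Curve k} (ε : (fieldPoint Y.scheme β).normalization ≅ Z.scheme)
    (fst : Z.scheme ⟶ W.scheme) (snd : Z.scheme ⟶ Y.scheme) (hstr : fst ≫ p.hom = snd ≫ f.hom)
    (hZ : fst ≫ W.str = Z.str)
    (hsnd' : ε.hom ≫ snd = (fieldPoint Y.scheme β).fromNormalization)
    (hfst' : (fieldPoint Y.scheme β).toNormalization ≫ ε.hom ≫ fst = fieldPoint W.scheme α) :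
    ∃ (g : Cover Z W) (q : Cover Z Y), g.hom = fst ∧ q.hom = snd ∧ IsModelOf g q α β := by
  obtain ⟨b, e₀, hb, he₀, -⟩ := exists_cover_normalization β hfin hsep
  let N := normalizationCurve β hfin hsep
  let ε' : N.scheme ≅ Z.scheme := ε
  have hη : ε'.hom (genericPoint (normalizationCurve β hfin hsep).scheme) =
      genericPoint Z.scheme := genericPoint_eq_of_isOpenImmersion ε'.hom
  have hbij : Function.Bijective (genericStalkMap ε'.hom hη) :=
    (bijective_genericStalkMap_iff _ _).mpr
      ((ConcreteCategory.isIso_iff_bijective _).mp inferInstance)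
  let ψ : Z.functionField →+* F := e₀.toRingHom.comp (genericStalkMap ε'.hom hη).hom
  have hψ : Function.Bijective ψ := e₀.bijective.comp hbij
  have hψτ : fieldPoint Z.scheme ψ = (fieldPoint Y.scheme β).toNormalization ≫ ε.hom := by
    rw [← fieldPoint_comp ε'.hom hη, he₀]
    rfl
  have hsnd : fieldPoint Z.scheme ψ ≫ snd = fieldPoint Y.scheme β := by
    rw [hψτ, Category.assoc, hsnd', Scheme.Hom.toNormalization_fromNormalization]
  have hfst : fieldPoint Z.scheme ψ ≫ fst = fieldPoint W.scheme α := by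
    rw [hψτ, Category.assoc, hfst']
  obtain ⟨x⟩ : Nonempty (Spec (.of F)) := ⟨closedPoint F⟩
  have hηq : snd (genericPoint Z.scheme) = genericPoint Y.scheme := by
    rw [← fieldPoint_apply ψ x, ← Scheme.Hom.comp_apply, hsnd, fieldPoint_apply]
  have hηg : fst (genericPoint Z.scheme) = genericPoint W.scheme := by
    rw [← fieldPoint_apply ψ x, ← Scheme.Hom.comp_apply, hfst, fieldPoint_apply]
  have hβ : ψ.comp (genericStalkMap snd hηq).hom = β := by
    apply fieldPoint_injective
    rw [← hsnd, fieldPoint_comp _ hηq]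
  have hα : ψ.comp (genericStalkMap fst hηg).hom = α := by
    apply fieldPoint_injective
    rw [← hfst, fieldPoint_comp _ hηg]
  have hfinq : IsFinite snd := by
    have : IsFinite (ε'.hom ≫ snd) := by
      rw [show ε'.hom ≫ snd = b.hom from hsnd'.trans hb.symm]
      infer_instance
    rw [show snd = ε'.inv ≫ ε'.hom ≫ snd by simp]
    infer_instance
  -- The composite of `fst` with p equals that of `snd` with f, which is finite; p is then
  -- cancelled. Separability of F over k(W) likewise comes from the tower over k(X).
  have hfing : IsFinite fst := by
    have : IsFinite (fst ≫ p.hom) := hstr ▸ inferInstance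
    exact IsFinite.of_comp _ p.hom
  have hsepα : letI := α.toAlgebra; Algebra.IsSeparable W.functionField F := by
    let := α.toAlgebra
    let := β.toAlgebra
    let := f.functionFieldAlgebra
    let := p.functionFieldAlgebra
    let := (α.comp p.functionFieldMap).toAlgebra
    have : IsScalarTower X.functionField W.functionField F := .of_algebraMap_eq' rfl
    have : IsScalarTower X.functionField Y.functionField F := .of_algebraMap_eq' hαβ
    have := f.isSeparable
    have : Algebra.IsSeparable X.functionField F := .trans X.functionField Y.functionField F
    exact Algebra.isSeparable_tower_top_of_isSeparable X.functionField W.functionField F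
  let q : Cover Z Y := Cover.ofIsSeparable snd
    (by rw [← f.w, ← reassoc_of% hstr, p.w, hZ]) hηq
    (isSeparable_of_comp_genericStalkMap _ hηq β ψ hβ hsep)
  let g : Cover Z W := Cover.ofIsSeparable fst hZ hηg
    (isSeparable_of_comp_genericStalkMap _ hηg α ψ hα hsepα)
  exact ⟨g, q, rfl, rfl, (RingEquiv.ofBijective ψ hψ).symm,
    fun a ↦ (RingEquiv.symm_apply_eq _).mpr congr($hα a).symm,
    fun b ↦ (RingEquiv.symm_apply_eq _).mpr congr($hβ b).symm⟩

theorem normalizedFiberProduct_condition :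
    normalizedFiberProductFst p f ≫ p.hom = normalizedFiberProductSnd p f ≫ f.hom :=
  congrArg (normalizationHom _ ≫ ·) pullback.condition

theorem exists_covers_normalizedFiberProduct
    (hαβ : α.comp p.functionFieldMap = β.comp f.functionFieldMap)
    (hF : ∀ (E : Type u) [Field E] (α' : W.functionField →+* E) (β' : Y.functionField →+* E),
      α'.comp p.functionFieldMap = β'.comp f.functionFieldMap →
      ∃ γ : F →+* E, γ.comp α = α' ∧ γ.comp β = β')
    (hfin : β.Finite) (hsep : letI := β.toAlgebra; Algebra.IsSeparable Y.functionField F) :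
    ∃ hZ : IsSmoothProjectiveCurve (normalizedFiberProductStr p f),
    ∃ (g : Cover ⟨normalizedFiberProduct p f, normalizedFiberProductStr p f, hZ⟩ W)
      (q : Cover ⟨normalizedFiberProduct p f, normalizedFiberProductStr p f, hZ⟩ Y),
      g.hom = normalizedFiberProductFst p f ∧ q.hom = normalizedFiberProductSnd p f ∧
      IsModelOf g q α β := by
  obtain ⟨i, hi⟩ := exists_iso_genericPoints p f α β hαβ hF
  obtain ⟨ε₀, hε₀, hε₀'⟩ := exists_iso_normalization (genericPointsHom (pullback p.hom f.hom))
    (pullback.snd p.hom f.hom) (fieldPoint Y.scheme β) i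
    (by rw [reassoc_of% hi, pullback.lift_snd])
  have hε₁ : (fieldPoint Y.scheme β).toNormalization ≫ ε₀.hom ≫
      (genericPointsHom (pullback p.hom f.hom)).fromNormalization ≫ pullback.fst p.hom f.hom =
      fieldPoint W.scheme α := by
    rw [reassoc_of% hε₀', Scheme.Hom.toNormalization_fromNormalization_assoc, reassoc_of% hi,
      pullback.lift_fst]
  obtain ⟨ε, hsnd, hfst⟩ : ∃ ε : (fieldPoint Y.scheme β).normalization ≅ normalizedFiberProduct p f,
      ε.hom ≫ normalizedFiberProductSnd p f = (fieldPoint Y.scheme β).fromNormalization ∧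
      (fieldPoint Y.scheme β).toNormalization ≫ ε.hom ≫ normalizedFiberProductFst p f =
        fieldPoint W.scheme α := ⟨ε₀, hε₀, hε₁⟩
  have hstr := normalizedFiberProduct_condition p f
  have hZ : IsSmoothProjectiveCurve (normalizedFiberProductStr p f) := by
    refine (isSmoothProjectiveCurve_normalization β hfin hsep).of_iso ε ?_
    rw [normalizedFiberProductStr, ← p.w, reassoc_of% hstr, f.w, reassoc_of% hsnd]
  exact ⟨hZ, exists_covers_of_iso_normalization p f α β hαβ hfin hsep
    (Z := ⟨_, _, hZ⟩) ε (normalizedFiberProductFst p f) (normalizedFiberProductSnd p f) hstr rfl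
    hsnd hfst⟩

end

/-! ### The compositum as a tensor product of fields. -/

section FieldTensorProduct

open scoped TensorProduct

variable {K A B : Type u} [Field K] [Field A] [Field B] [Algebra K A] [Algebra K B]

/-- Inside an algebraic closure of B, the intersection of the images of A and B is a subextension of
B that embeds in A, so it is K. As A is Galois, trivial intersection gives linear disjointness. -/
theorem isField_tensorProduct [FiniteDimensional K A] [IsGalois K A] [FiniteDimensional K B]
    (h : ∀ (L : IntermediateField K B) (_ : L →ₐ[K] A), L = ⊥) : IsField (B ⊗[K] A) := by
  let fa : A →ₐ[K] AlgebraicClosure B := IsAlgClosed.lift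
  let fb : B →ₐ[K] AlgebraicClosure B := IsScalarTower.toAlgHom K B _
  let ea : A ≃ₐ[K] fa.fieldRange := AlgEquiv.ofInjectiveField fa
  let eb : B ≃ₐ[K] fb.fieldRange := AlgEquiv.ofInjectiveField fb
  have : FiniteDimensional K fa.fieldRange := ea.toLinearEquiv.finiteDimensional
  have : FiniteDimensional K fb.fieldRange := eb.toLinearEquiv.finiteDimensional
  have : IsGalois K fa.fieldRange := IsGalois.of_algEquiv ea
  have hinf : fa.fieldRange ⊓ fb.fieldRange = ⊥ := by
    let j : fa.fieldRange.comap fb →ₐ[K] fa.fieldRange :=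
      (fb.comp (fa.fieldRange.comap fb).val).codRestrict fa.fieldRange.toSubalgebra fun x ↦ x.2
    rw [eq_bot_iff]
    rintro _ ⟨hx, x, rfl⟩
    have hx' : x ∈ fa.fieldRange.comap fb := hx
    rw [h _ (ea.symm.toAlgHom.comp j)] at hx'
    obtain ⟨y, rfl⟩ := IntermediateField.mem_bot.mp hx'
    exact IntermediateField.mem_bot.mpr ⟨y, (fb.commutes y).symm⟩
  exact (IntermediateField.LinearDisjoint.of_inf_eq_bot hinf).symm.isField_of_isAlgebraic'
    (.inl inferInstance)

theorem exists_field_tensorProduct [FiniteDimensional K A] [IsGalois K A] [FiniteDimensional K B]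
    (h : ∀ (L : IntermediateField K B) (_ : L →ₐ[K] A), L = ⊥) :
    ∃ (F : Type u) (_ : Field F) (α : A →+* F) (β : B →+* F),
      α.comp (algebraMap K A) = β.comp (algebraMap K B) ∧
      (∀ (E : Type u) [Field E] (α' : A →+* E) (β' : B →+* E),
        α'.comp (algebraMap K A) = β'.comp (algebraMap K B) →
        ∃ γ : F →+* E, γ.comp α = α' ∧ γ.comp β = β') ∧
      β.Finite ∧ (letI := β.toAlgebra; Algebra.IsSeparable B F) ∧
      ∀ T : Subfield F, (∀ a, α a ∈ T) → (∀ b, β b ∈ T) → T = ⊤ := by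
  let field := (isField_tensorProduct h).toField
  have hfin : Module.Finite B (B ⊗[K] A) := inferInstance
  have halg : (Algebra.TensorProduct.includeLeftRingHom : B →+* B ⊗[K] A).toAlgebra =
      Algebra.TensorProduct.leftAlgebra := Algebra.algebra_ext _ _ fun _ ↦ rfl
  refine ⟨B ⊗[K] A, field, Algebra.TensorProduct.includeRight.toRingHom,
    Algebra.TensorProduct.includeLeftRingHom, ?_, ?_, ?_, ?_, ?_⟩
  · ext x
    exact (Algebra.TensorProduct.includeRight.commutes x).trans
      (Algebra.TensorProduct.algebraMap_apply x)
  · intro E _ α' β' hE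
    let := (β'.comp (algebraMap K B)).toAlgebra
    let a : A →ₐ[K] E := { α' with commutes' := fun x ↦ congr($hE x) }
    let b : B →ₐ[K] E := { β' with commutes' := fun x ↦ rfl }
    have hba (x y) : Commute (b x) (a y) := Commute.all _ _
    refine ⟨(Algebra.TensorProduct.lift b a hba).toRingHom, ?_, ?_⟩
    · ext x
      exact (Algebra.TensorProduct.lift_tmul b a hba 1 x).trans (by simp [a])
    · ext x
      exact (Algebra.TensorProduct.lift_tmul b a hba x 1).trans (by simp [b])
  · rw [RingHom.Finite, halg]
    exact hfin
  · rw [halg]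
    -- Separability is carried through the base change in the form of formal étaleness.
    have : Algebra.FormallyEtale K A := (Algebra.FormallyEtale.iff_isSeparable K A).mpr inferInstance
    have : Algebra.FormallyEtale B (B ⊗[K] A) := inferInstance
    have : Algebra.EssFiniteType B (B ⊗[K] A) := inferInstance
    exact (Algebra.FormallyEtale.iff_isSeparable B (B ⊗[K] A)).mp inferInstance
  · intro T hA hB
    rw [eq_top_iff]
    intro x _
    induction x with
    | zero => exact T.zero_mem
    | add x y hx hy => exact T.add_mem (hx trivial) (hy trivial)
    | tmul b a =>
      have := T.mul_mem (hB b) (hA a)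
      convert this
      exact (by simp : b ⊗ₜ[K] a = (b ⊗ₜ[K] 1) * (1 ⊗ₜ[K] a))

end FieldTensorProduct

/-! ### Galois theory of a compositum. -/

section Compositum

variable {F K L E : Type*} [Field F] [Field K] [Field L] [Field E] [Algebra F K] [Algebra F L]
  [Algebra F E] [Algebra K E] [Algebra L E] [IsScalarTower F K E] [IsScalarTower F L E]

theorem isGalois_of_compositum_eq_top [IsGalois F K] [FiniteDimensional F K]
    (hgen : ∀ T : Subfield E, (∀ a, algebraMap K E a ∈ T) → (∀ b, algebraMap L E b ∈ T) → T = ⊤) :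
    IsGalois L E := by
  let fK := IsScalarTower.toAlgHom F K E
  let fL := IsScalarTower.toAlgHom F L E
  let eK : K ≃ₐ[F] fK.fieldRange := AlgEquiv.ofInjectiveField fK
  let eL : L ≃ₐ[F] fL.fieldRange := AlgEquiv.ofInjectiveField fL
  have : FiniteDimensional F fK.fieldRange := eK.toLinearEquiv.finiteDimensional
  have : IsGalois F fK.fieldRange := IsGalois.of_algEquiv eK
  have hsup : fK.fieldRange ⊔ fL.fieldRange = ⊤ := by
    rw [eq_top_iff]
    intro x _
    have := hgen (fK.fieldRange ⊔ fL.fieldRange).toSubfield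
      (fun a ↦ (le_sup_left : fK.fieldRange ≤ fK.fieldRange ⊔ fL.fieldRange) ⟨a, rfl⟩)
      (fun b ↦ (le_sup_right : fL.fieldRange ≤ fK.fieldRange ⊔ fL.fieldRange) ⟨b, rfl⟩)
    have hx : x ∈ (fK.fieldRange ⊔ fL.fieldRange).toSubfield := this ▸ Subfield.mem_top x
    exact hx
  have := IsGalois.sup_right _ _ hsup
  exact IsGalois.of_equiv_equiv (F := fL.fieldRange) (E := E) (f := eL.symm.toRingEquiv)
    (g := RingEquiv.refl E) (RingHom.ext fun x ↦ congrArg Subtype.val (eL.apply_symm_apply x))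

theorem algebraMap_restrictRestrictAlgEquivMapHom [Normal F K] (σ : Gal(E/L)) (a : K) :
    algebraMap K E (IntermediateField.restrictRestrictAlgEquivMapHom F K L E σ a) =
      σ (algebraMap K E a) :=
  AlgEquiv.restrictNormal_commutes (MulSemiringAction.toAlgAut Gal(E/L) F E σ) K a

theorem injective_restrictRestrictAlgEquivMapHom [Normal F K]
    (hgen : ∀ T : Subfield E, (∀ a, algebraMap K E a ∈ T) → (∀ b, algebraMap L E b ∈ T) → T = ⊤) :
    Function.Injective (IntermediateField.restrictRestrictAlgEquivMapHom F K L E) := by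
  refine (injective_iff_map_eq_one _).mpr fun σ hσ ↦ AlgEquiv.ext fun x ↦ ?_
  have h := hgen (RingHom.eqLocusField σ.toRingEquiv.toRingHom (RingHom.id E))
    (fun a ↦ by
      have := algebraMap_restrictRestrictAlgEquivMapHom (F := F) σ a
      rw [hσ] at this
      exact this.symm) (fun b ↦ σ.commutes b)
  exact (h ▸ Subfield.mem_top x : x ∈ RingHom.eqLocusField _ _)

/-- An element of K fixed by the image of restriction is fixed by Gal(E/L), so it lies in K ∩ L = F.
By the Galois correspondence the image is the whole group. -/
theorem bijective_restrictRestrictAlgEquivMapHom [IsGalois F K] [FiniteDimensional F K]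
    [FiniteDimensional L E]
    (hgen : ∀ T : Subfield E, (∀ a, algebraMap K E a ∈ T) → (∀ b, algebraMap L E b ∈ T) → T = ⊤)
    (hinf : ∀ a b, algebraMap K E a = algebraMap L E b → a ∈ Set.range (algebraMap F K)) :
    Function.Bijective (IntermediateField.restrictRestrictAlgEquivMapHom F K L E) := by
  have := isGalois_of_compositum_eq_top (F := F) hgen
  refine ⟨injective_restrictRestrictAlgEquivMapHom hgen, ?_⟩
  · let G := (IntermediateField.restrictRestrictAlgEquivMapHom F K L E).range
    suffices hbot : IntermediateField.fixedField G = ⊥ by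
      rw [← MonoidHom.range_eq_top]
      exact (IntermediateField.fixingSubgroup_fixedField G).symm.trans
        (hbot ▸ IntermediateField.fixingSubgroup_bot)
    refine eq_bot_iff.mpr fun x hx ↦ ?_
    obtain ⟨y, hy⟩ : algebraMap K E x ∈ Set.range (algebraMap L E) := by
      refine IntermediateField.mem_bot.mp ((IsGalois.mem_bot_iff_fixed _).mpr fun σ ↦ ?_)
      rw [← algebraMap_restrictRestrictAlgEquivMapHom (F := F)]
      exact congrArg _ ((IntermediateField.mem_fixedField_iff _ _).mp hx _ ⟨σ, rfl⟩)
    exact IntermediateField.mem_bot.mpr (hinf x y hy.symm)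

/-- A subfield of the compositum of a Galois extension `K` of `F` and an extension `L` of `F` that
contains `K`, is stable under the automorphisms over `L` and meets `L` in `F` is equal to `K`. -/
theorem mem_range_algebraMap_of_stable [IsGalois F K] [FiniteDimensional F K]
    [FiniteDimensional F L] [FiniteDimensional L E]
    (hgen : ∀ T : Subfield E, (∀ a, algebraMap K E a ∈ T) → (∀ b, algebraMap L E b ∈ T) → T = ⊤)
    (T : Subfield E) (hK : ∀ a, algebraMap K E a ∈ T)
    (hG : ∀ σ : Gal(E/L), ∀ t ∈ T, σ t ∈ T)
    (hL : ∀ b, algebraMap L E b ∈ T → b ∈ Set.range (algebraMap F L)) {t : E} (ht : t ∈ T) :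
    t ∈ Set.range (algebraMap K E) := by
  have := isGalois_of_compositum_eq_top (F := F) hgen
  have : FiniteDimensional F E := .trans F L E
  let T' : IntermediateField F E := T.toIntermediateField fun x ↦ by
    rw [IsScalarTower.algebraMap_apply F K E]
    exact hK _
  have : IsInvariantSubfield Gal(E/L) T := ⟨fun σ x hx ↦ hG σ x hx⟩
  let := IsInvariantSubfield.toMulSemiringAction Gal(E/L) T
  let i : F →+* FixedPoints.subfield Gal(E/L) T := (algebraMap F T').codRestrict _ fun x σ ↦
    Subtype.ext (by
      change σ (algebraMap F E x) = algebraMap F E x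
      rw [IsScalarTower.algebraMap_apply F L E, σ.commutes])
  -- The fixed field of Gal(E/L) acting on T is T ∩ L = F.
  have hi : Function.Bijective i := by
    refine ⟨i.injective, fun x ↦ ?_⟩
    obtain ⟨b, hb⟩ : (x : T).1 ∈ Set.range (algebraMap L E) :=
      IntermediateField.mem_bot.mp ((IsGalois.mem_bot_iff_fixed _).mpr fun σ ↦
        congrArg Subtype.val (x.2 σ))
    obtain ⟨c, rfl⟩ := hL b (hb ▸ (x : T).2)
    refine ⟨c, Subtype.ext (Subtype.ext ?_)⟩
    rw [← hb, ← IsScalarTower.algebraMap_apply]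
    rfl
  -- Artin's bound: [T : F] ≤ |Gal(E/L)| ≤ |Gal(K/F)| = [K : F]. Since K embeds in T, equality
  -- follows.
  have hrank : Module.finrank F T' ≤ Module.finrank F K := by
    have h1 : Module.finrank F T' = Module.finrank (FixedPoints.subfield Gal(E/L) T) T :=
      Algebra.finrank_eq_of_equiv_equiv (RingEquiv.ofBijective i hi) (RingEquiv.refl T) rfl
    have h2 : Nat.card Gal(E/L) ≤ Nat.card Gal(K/F) := 
      Nat.card_le_card_of_injective _ (injective_restrictRestrictAlgEquivMapHom hgen)
    rw [h1, ← IsGalois.card_aut_eq_finrank F K]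
    refine le_trans ?_ h2
    rw [Nat.card_eq_fintype_card]
    exact FixedPoints.finrank_le_card _ _
  let j : K →ₗ[F] T' := ((IsScalarTower.toAlgHom F K E).codRestrict T'.toSubalgebra hK).toLinearMap
  have hj : Function.Injective j := fun a b hab ↦
    (algebraMap K E).injective (congrArg Subtype.val hab)
  have hsurj := (LinearMap.injective_iff_surjective_of_finrank_eq_finrank
    ((LinearMap.finrank_le_finrank_of_injective hj).antisymm hrank)).mp hj
  obtain ⟨a, ha⟩ := hsurj ⟨t, ht⟩
  exact ⟨a, congrArg Subtype.val ha⟩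

end Compositum

/-! ### The key consequence of genuine ramification. -/

section GenuinelyRamified

variable {k : Type u} [Field k] {X Y C D : Curve k}

theorem Cover.surjective_hom (f : Cover Y X) : Function.Surjective f.hom := by
  intro x
  have hclosed : IsClosed (Set.range f.hom) := f.hom.isClosedMap.isClosed_range
  exact (genericPoint_specializes x).mem_closed hclosed ⟨_, f.map_genericPoint⟩

theorem Cover.mapPoint_surjective (f : Cover Y X) : Function.Surjective f.mapPoint := by
  rintro ⟨x, hx⟩
  have hclosed : IsClosed (f.hom ⁻¹' {x}) := hx.preimage f.hom.continuous
  have : CompactSpace Y.scheme := QuasiCompact.compactSpace_of_compactSpace Y.str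
  obtain ⟨y, hyx, hy⟩ := hclosed.exists_closed_singleton (f.surjective_hom x)
  exact ⟨⟨y, hy⟩, Subtype.ext hyx⟩

/-- The passage from global to local: the local field of D at y is generated by that of X and by
k(D), and whether k(D) lies in P can be tested at a point of C above y. -/
theorem Cover.transportSubfield_eq_top {a : Cover C D} {b : Cover D X} {P : BranchData X}
    (h : ∀ l, a.functionFieldMap l ∈ (a.comp b (a.genericallySmooth_comp b)).splitField P)
    (y : D.ClosedPoint) :
    transportSubfield (b.localFieldMap y) (P.field (b.mapPoint y)) = ⊤ := by
  obtain ⟨z, rfl⟩ := a.mapPoint_surjective y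
  refine b.subfield_localField_eq_top _ _ (fun x ↦ ?_) fun t ↦ ?_
  · exact algebraMap_mem_transport _ _ x
  · rw [← a.localFieldMap_mem_transportSubfield b (a.genericallySmooth_comp b),
      ← Cover.toLocalField_functionFieldMap]
    exact Cover.mem_splitField.mp (h t) z

/-- If `f` is genuinely ramified, then a subextension of `k(Y)/k(X)` that embeds into some `k(C)`
with image in the split field of `P` is trivial. -/
theorem IsGenuinelyRamified.surjective {P : BranchData X} {f : Cover Y X}
    (hf : IsGenuinelyRamified f P) {L : Type u} [Field L] (φ : X.functionField →+* L)
    (i : L →+* Y.functionField) (hi : i.comp φ = f.functionFieldMap) (c : Cover C X)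
    (j : L →+* C.functionField) (hj : j.comp φ = c.functionFieldMap)
    (hT : ∀ l, j l ∈ c.splitField P) : Function.Surjective φ := by
  have hfs : φ.Finite ∧ (letI := φ.toAlgebra; Algebra.IsSeparable X.functionField L) := by
    let := φ.toAlgebra
    let := i.toAlgebra
    let := f.functionFieldAlgebra
    have := f.finiteDimensional
    have := f.isSeparable
    have : IsScalarTower X.functionField L Y.functionField := .of_algebraMap_eq' hi.symm
    exact ⟨FiniteDimensional.left X.functionField L Y.functionField,
      Algebra.isSeparable_tower_bot_of_isSeparable X.functionField L Y.functionField⟩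
  -- L is realized by a curve D over X, and both embeddings of L become covers of D. The one from C
  -- shows that D is étale over (X, P), the one from Y that D is intermediate in `f`.
  obtain ⟨b, e, -, -, he⟩ := exists_cover_normalization φ hfs.1 hfs.2
  obtain ⟨a, ha, -⟩ := f.exists_cover_functionFieldMap_eq b (i.comp e.toRingHom)
    (by rw [RingHom.comp_assoc, he, hi])
  obtain ⟨a', ha', ha''⟩ := c.exists_cover_functionFieldMap_eq b (j.comp e.toRingHom)
    (by rw [RingHom.comp_assoc, he, hj])
  obtain rfl : a.comp b (a.genericallySmooth_comp b) = f := Cover.ext ha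
  obtain rfl : a'.comp b (a'.genericallySmooth_comp b) = c := Cover.ext ha'
  have := IsGenuinelyRamified.isIso a b _ hf (Cover.transportSubfield_eq_top (a := a') fun l ↦ by
    rw [ha'']
    exact hT _)
  rw [← he]
  exact e.surjective.comp b.bijective_of_isIso.2

end GenuinelyRamified

/-! ### Base change of a genuinely ramified morphism. -/

section Main

variable {k : Type u} [Field k] {X Y W Z : Curve k} {P : BranchData X} {f : Cover Y X}
  {p : Cover W X}

/-- Since W is étale over (X, P), every function on W is in the split field, so the key statement
applies with C = W. -/
theorem IsGenuinelyRamified.eq_bot (hf : IsGenuinelyRamified f P)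
    (hp : IsEtale p (BranchData.trivial W) P) :
    letI := p.functionFieldAlgebra
    letI := f.functionFieldAlgebra
    ∀ (L : IntermediateField X.functionField Y.functionField)
      (_ : L →ₐ[X.functionField] W.functionField), L = ⊥ := by
  let := p.functionFieldAlgebra
  let := f.functionFieldAlgebra
  intro L j
  have := hf.surjective (algebraMap X.functionField L) L.val.toRingHom rfl p j.toRingHom
    j.comp_algebraMap fun l ↦ hp.splitField_eq_top ▸ Subfield.mem_top _
  rw [eq_bot_iff]
  intro x hx
  obtain ⟨y, hy⟩ := this ⟨x, hx⟩
  exact IntermediateField.mem_bot.mpr ⟨y, congrArg Subtype.val hy⟩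

theorem IsEtale.comp_trivial
    (hp : IsEtale p (BranchData.trivial W) P) {V : Curve k} {Q : BranchData V} {b : Cover V W}
    (hb : IsEtale b Q (BranchData.trivial W)) :
    IsEtale (b.comp p (b.genericallySmooth_comp p)) Q P := by
  intro y
  rw [transport_comp_localFieldMap, hp]
  exact hb y

/-- The function field of `Z` is generated by those of `W` and `Y`. -/
def GenerateFunctionField (g : Cover Z W) (q : Cover Z Y) : Prop :=
  ∀ T : Subfield Z.functionField, (∀ a, g.functionFieldMap a ∈ T) →
    (∀ b, q.functionFieldMap b ∈ T) → T = ⊤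

theorem IsModelOf.generateFunctionField {F : Type u} [Field F] {g : Cover Z W} {q : Cover Z Y}
    {α : W.functionField →+* F} {β : Y.functionField →+* F} (h : IsModelOf g q α β)
    (hgen : ∀ T : Subfield F, (∀ a, α a ∈ T) → (∀ b, β b ∈ T) → T = ⊤) :
    GenerateFunctionField g q := by
  obtain ⟨e, hα, hβ⟩ := h
  refine fun T ha hb ↦ eq_top_iff.mpr fun x _ ↦ ?_
  have h := hgen (T.comap e.toRingHom) (fun a ↦ ?_) (fun b ↦ ?_)
  · have hx : e.symm x ∈ T.comap e.toRingHom := h ▸ Subfield.mem_top _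
    rw [Subfield.mem_comap] at hx
    exact (e.apply_symm_apply x) ▸ hx
  · exact Subfield.mem_comap.mpr ((hα a).symm ▸ ha a)
  · exact Subfield.mem_comap.mpr ((hβ b).symm ▸ hb b)

theorem Cover.comp_eq_comp {g : Cover Z W} {q : Cover Z Y} (hgq : g.hom ≫ p.hom = q.hom ≫ f.hom) :
    g.comp p (g.genericallySmooth_comp p) = q.comp f (q.genericallySmooth_comp f) :=
  Cover.ext hgq

theorem Cover.functionFieldMap_comp_eq {g : Cover Z W} {q : Cover Z Y}
    (hgq : g.hom ≫ p.hom = q.hom ≫ f.hom) :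
    g.functionFieldMap.comp p.functionFieldMap = q.functionFieldMap.comp f.functionFieldMap := by
  rw [← Cover.functionFieldMap_comp _ _ (g.genericallySmooth_comp p), Cover.comp_eq_comp hgq,
    Cover.functionFieldMap_comp]

theorem IsEtale.functionFieldMap_mem_splitField (hp : IsEtale p (BranchData.trivial W) P)
    (g : Cover Z W) (x : W.functionField) :
    g.functionFieldMap x ∈ (g.comp p (g.genericallySmooth_comp p)).splitField P :=
  Cover.functionFieldMap_mem_splitField _ _ _ P (hp.splitField_eq_top ▸ Subfield.mem_top x)

/-- The field T ∩ k(Y), with T the split field of Z over X, is a subextension of k(Y) that embeds in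
T; the key statement with C = Z makes it k(X). -/
theorem IsGenuinelyRamified.mem_range_functionFieldMap (hf : IsGenuinelyRamified f P)
    (hp : IsEtale p (BranchData.trivial W) P) {g : Cover Z W} {q : Cover Z Y}
    (hgq : g.hom ≫ p.hom = q.hom ≫ f.hom) {y : Y.functionField}
    (hy : q.functionFieldMap y ∈ (g.comp p (g.genericallySmooth_comp p)).splitField P) :
    y ∈ Set.range f.functionFieldMap := by
  have hpf := Cover.functionFieldMap_comp_eq hgq
  let L := ((g.comp p (g.genericallySmooth_comp p)).splitField P).comap q.functionFieldMap
  let φ : X.functionField →+* L := f.functionFieldMap.codRestrict L fun x ↦ by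
    change q.functionFieldMap.comp f.functionFieldMap x ∈
      (g.comp p (g.genericallySmooth_comp p)).splitField P
    rw [← hpf]
    exact hp.functionFieldMap_mem_splitField g _
  obtain ⟨x, hx⟩ := hf.surjective φ L.subtype rfl (g.comp p (g.genericallySmooth_comp p))
    (q.functionFieldMap.comp L.subtype)
    (by rw [Cover.functionFieldMap_comp, hpf]; rfl) (fun l ↦ l.2) ⟨y, hy⟩
  exact ⟨x, congrArg Subtype.val hx⟩

/-- A genuinely ramified morphism stays so after base change along an étale Galois cover. -/
theorem IsGenuinelyRamified.of_compositum (hf : IsGenuinelyRamified f P)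
    (hp : IsEtale p (BranchData.trivial W) P) (hGal : p.IsGaloisCover)
    {g : Cover Z W} {q : Cover Z Y} (hgq : g.hom ≫ p.hom = q.hom ≫ f.hom)
    (hgen : GenerateFunctionField g q) :
    IsGenuinelyRamified g (BranchData.trivial W) := by
  intro V Q a b hab _ hb
  have hc : g.comp p (g.genericallySmooth_comp p) = q.comp f (q.genericallySmooth_comp f) :=
    Cover.ext hgq
  have hc := Cover.comp_eq_comp hgq
  have hVX := hp.comp_trivial hb
  let T := (g.comp p (g.genericallySmooth_comp p)).splitField P
  have hpf : g.functionFieldMap.comp p.functionFieldMap =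
      q.functionFieldMap.comp f.functionFieldMap := by
    rw [← Cover.functionFieldMap_comp _ _ (g.genericallySmooth_comp p), hc,
      Cover.functionFieldMap_comp]
  have hK (x) : g.functionFieldMap x ∈ T := hp.functionFieldMap_mem_splitField g x
  -- A self-cover of Z over Y is also one over X, so it preserves T. Every automorphism of k(Z) over
  -- k(Y) arises this way.
  have hG (s : Cover Z Z) (hs : s.hom ≫ q.hom = q.hom) (t) (ht : t ∈ T) :
      s.functionFieldMap t ∈ T := by
    have := Cover.functionFieldMap_mem_splitField s _ (Cover.genericallySmooth_comp s _) P ht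
    convert this using 2
    refine Cover.ext ?_
    rw [hc]
    exact (congrArg (· ≫ f.hom) hs).symm.trans (Category.assoc _ _ _)
  let := p.functionFieldAlgebra
  let := f.functionFieldAlgebra
  let := g.functionFieldAlgebra
  let := q.functionFieldAlgebra
  let : Algebra X.functionField Z.functionField :=
    (g.functionFieldMap.comp p.functionFieldMap).toAlgebra
  have : IsScalarTower X.functionField W.functionField Z.functionField := .of_algebraMap_eq' rfl
  have : IsScalarTower X.functionField Y.functionField Z.functionField := .of_algebraMap_eq' hpf
  have := p.finiteDimensional
  have := f.finiteDimensional
  have := q.finiteDimensional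
  have : IsGalois X.functionField W.functionField := hGal
  have hL (y) (hy : q.functionFieldMap y ∈ T) := hf.mem_range_functionFieldMap hp hgq hy
  have hT {t} (ht : t ∈ T) : t ∈ Set.range g.functionFieldMap := by
    refine mem_range_algebraMap_of_stable (F := X.functionField) (K := W.functionField)
      (L := Y.functionField) hgen T hK (fun σ t ht ↦ ?_) hL ht
    obtain ⟨s, hs, hs'⟩ := q.exists_cover_functionFieldMap_eq q σ.toRingEquiv.toRingHom
      (RingHom.ext σ.commutes)
    have := hG s hs t ht
    rwa [hs'] at this
  refine b.isIso_of_bijective ⟨b.functionFieldMap.injective, fun v ↦ ?_⟩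
  have hgab : a.comp b (a.genericallySmooth_comp b) = g := Cover.ext hab
  -- V is étale over (X, P) through W, so all of k(V) lies in T, which has been shown to be k(W).
  have hv : a.functionFieldMap v ∈ T := by
    have := Cover.functionFieldMap_mem_splitField a _ (Cover.genericallySmooth_comp a _) P
      (hVX.splitField_eq_top ▸ Subfield.mem_top v)
    convert this using 2
    refine Cover.ext ?_
    rw [← hgab]
    exact Category.assoc _ _ _
  obtain ⟨w, hw⟩ := hT hv
  refine ⟨w, a.functionFieldMap.injective ?_⟩
  rw [← hw, ← hgab, Cover.functionFieldMap_comp]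
  rfl

/-- In one direction, P equals the local field of W, so f^*P lies in the local field of Z. In the
other, the local field of Z is generated by that of Y together with k(W) and k(Y), and k(W) lies in
P. -/
theorem isEtale_of_compositum
    (hp : IsEtale p (BranchData.trivial W) P)
    {g : Cover Z W} {q : Cover Z Y} (hgq : g.hom ≫ p.hom = q.hom ≫ f.hom)
    (hgen : GenerateFunctionField g q) :
    IsEtale q (BranchData.trivial Z) (P.pullback f) := by
  have hc : g.comp p (g.genericallySmooth_comp p) = q.comp f (q.genericallySmooth_comp f) :=
    Cover.ext hgq
  intro z
  refine subset_antisymm ?_ ?_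
  · refine algClosureMap_image_compositum_subset (f.localFieldMap (q.mapPoint z)) _
      (P.field (f.mapPoint (q.mapPoint z))) _ ?_
    rw [← transport_comp_localFieldMap q f (q.genericallySmooth_comp f), ← hc,
      transport_comp_localFieldMap, hp]
    rintro _ ⟨_, hx, rfl⟩
    obtain ⟨x, rfl⟩ := IntermediateField.mem_bot.mp hx
    rw [algClosureMap_algebraMap]
    exact IntermediateField.algebraMap_mem _ _
  · rintro _ hx
    obtain ⟨x, rfl⟩ := IntermediateField.mem_bot.mp hx
    suffices h : transportSubfield (q.localFieldMap z) ((P.pullback f).field (q.mapPoint z)) = ⊤ by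
      have hx : x ∈ transportSubfield (q.localFieldMap z) ((P.pullback f).field (q.mapPoint z)) :=
        h ▸ Subfield.mem_top x
      exact hx
    refine q.subfield_localField_eq_top _ _ (fun x ↦ algebraMap_mem_transport _ _ x) fun t ↦ ?_
    have := hgen ((transportSubfield (q.localFieldMap z)
      ((P.pullback f).field (q.mapPoint z))).comap (Z.toLocalField z)) (fun a ↦ ?_) (fun b ↦ ?_)
    · exact (this ▸ Subfield.mem_top t : t ∈ Subfield.comap _ _)
    · have h : a ∈ p.splitField P := hp.splitField_eq_top ▸ Subfield.mem_top a
      have h := Cover.mem_splitField.mp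
        (Cover.functionFieldMap_mem_splitField g _ (g.genericallySmooth_comp p) P h) z
      rw [hc, mem_transportSubfield, transport_comp_localFieldMap] at h
      exact Set.image_mono (transport_subset_compositum _ _) h
    · rw [Subfield.mem_comap, Cover.toLocalField_functionFieldMap]
      exact algebraMap_mem_transport _ _ _

/-- Since k(W) lies in the split field of Z, its intersection with k(Y) is k(X); restriction of
automorphisms to k(W) is then bijective. -/
theorem exists_mulEquiv_of_compositum (hf : IsGenuinelyRamified f P)
    (hp : IsEtale p (BranchData.trivial W) P) (hGal : p.IsGaloisCover)
    {g : Cover Z W} {q : Cover Z Y} (hgq : g.hom ≫ p.hom = q.hom ≫ f.hom)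
    (hgen : GenerateFunctionField g q) :
    q.IsGaloisCover ∧ ∃ e : q.GaloisGroup ≃* p.GaloisGroup, ∀ σ a,
      g.functionFieldMap (e σ a) = σ (g.functionFieldMap a) := by
  have hpf := Cover.functionFieldMap_comp_eq hgq
  let := p.functionFieldAlgebra
  let := f.functionFieldAlgebra
  let := g.functionFieldAlgebra
  let := q.functionFieldAlgebra
  let : Algebra X.functionField Z.functionField :=
    (g.functionFieldMap.comp p.functionFieldMap).toAlgebra
  have : IsScalarTower X.functionField W.functionField Z.functionField := .of_algebraMap_eq' rfl
  have : IsScalarTower X.functionField Y.functionField Z.functionField := .of_algebraMap_eq' hpf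
  have := p.finiteDimensional
  have := f.finiteDimensional
  have := q.finiteDimensional
  have : IsGalois X.functionField W.functionField := hGal
  have hinf (a : W.functionField) (b : Y.functionField)
      (hab : g.functionFieldMap a = q.functionFieldMap b) :
      a ∈ Set.range p.functionFieldMap := by
    obtain ⟨x, rfl⟩ := hf.mem_range_functionFieldMap hp hgq
      (hab ▸ hp.functionFieldMap_mem_splitField g a)
    exact ⟨x, g.functionFieldMap.injective ((RingHom.congr_fun hpf x).trans hab.symm)⟩
  refine ⟨isGalois_of_compositum_eq_top (F := X.functionField) (K := W.functionField) hgen,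
    MulEquiv.ofBijective _ (bijective_restrictRestrictAlgEquivMapHom (F := X.functionField)
      (K := W.functionField) (L := Y.functionField) (E := Z.functionField) hgen hinf), ?_⟩
  exact algebraMap_restrictRestrictAlgEquivMapHom

/-- The base change of a genuinely ramified morphism along an étale Galois cover. -/
theorem exists_covers_normalizedFiberProduct_of_isGenuinelyRamified
    (hf : IsGenuinelyRamified f P) (hp : IsEtale p (BranchData.trivial W) P)
    (hGal : p.IsGaloisCover) :
    ∃ hZ : IsSmoothProjectiveCurve (normalizedFiberProductStr p f),
    ∃ (g : Cover ⟨normalizedFiberProduct p f, normalizedFiberProductStr p f, hZ⟩ W)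
      (q : Cover ⟨normalizedFiberProduct p f, normalizedFiberProductStr p f, hZ⟩ Y),
      g.hom = normalizedFiberProductFst p f ∧ q.hom = normalizedFiberProductSnd p f ∧
      GenerateFunctionField g q := by
  let := p.functionFieldAlgebra
  let := f.functionFieldAlgebra
  have := p.finiteDimensional
  have := f.finiteDimensional
  have : IsGalois X.functionField W.functionField := hGal
  obtain ⟨F, _, α, β, hαβ, hF, hfin, hsep, hgen⟩ := exists_field_tensorProduct (hf.eq_bot hp)
  obtain ⟨hZ, g, q, hg, hq, h⟩ := exists_covers_normalizedFiberProduct p f α β hαβ hF hfin hsep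
  exact ⟨hZ, g, q, hg, hq, h.generateFunctionField hgen⟩

end Main

end FormalOrbifold

open FormalOrbifold
theorem lemma3p2 {k : Type u} [Field k] [IsAlgClosed k] {X Y W : Curve k}
    (P : BranchData X) (f : Cover Y X) (hf : IsGenuinelyRamified f P)
    (p : Cover W X) (hp : IsEtale p (BranchData.trivial W) P) (hGal : p.IsGaloisCover)
    {Γ : Type*} [Group Γ] (e : Γ ≃* p.GaloisGroup) :
    ∃ hZ : IsSmoothProjectiveCurve (normalizedFiberProductStr p f),
    ∃ (g : Cover ⟨normalizedFiberProduct p f, normalizedFiberProductStr p f, hZ⟩ W)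
      (q : Cover ⟨normalizedFiberProduct p f, normalizedFiberProductStr p f, hZ⟩ Y),
      g.hom = normalizedFiberProductFst p f ∧
      q.hom = normalizedFiberProductSnd p f ∧
      IsGenuinelyRamified g (BranchData.trivial W) ∧
      IsEtale q (BranchData.trivial _) (P.pullback f) ∧
      q.IsGaloisCover ∧
      ∃ e' : Γ ≃* q.GaloisGroup, ∀ (γ : Γ) (a : W.functionField),
        e' γ (g.functionFieldMap a) = g.functionFieldMap (e γ a) := by
  obtain ⟨hZ, g, q, hg, hq, hgen⟩ :=
    exists_covers_normalizedFiberProduct_of_isGenuinelyRamified hf hp hGal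
  have hgq : g.hom ≫ p.hom = q.hom ≫ f.hom := by
    rw [hg, hq]
    exact normalizedFiberProduct_condition p f
  obtain ⟨hq', e', he'⟩ := exists_mulEquiv_of_compositum hf hp hGal hgq hgen
  refine ⟨hZ, g, q, hg, hq, hf.of_compositum hp hGal hgq hgen, isEtale_of_compositum hp hgq hgen,
    hq', e.trans e'.symm, fun γ a ↦ ?_⟩
  rw [← he']
  exact congrArg (fun σ : p.GaloisGroup ↦ g.functionFieldMap (σ a)) (e'.apply_symm_apply (e γ))
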